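/- Let $p$ be a prime, $G$ a finite group (we do not require $p \mid |G|$), $k$ an algebraically closed field of characteristic $p$, and $S$ a Sylow $p$-subgroup of $G$. All $kG$-modules are finitely generated and all $G$-sets are finite and non-empty. A $p$-permutation module is a direct summand of a permutation module $kX$ (here the set $X$ may be empty, so that the zero module is allowed). A vertex of an indecomposable $kG$-module $M$ is a minimal subgroup $H \le G$ such that $M$ is a direct summand of $\mathrm{Ind}_H^G \mathrm{Res}^G_H M$. A $kG$-module $M$ is a Dade module if $\mathrm{End}_k(M) \cong k^n \oplus W$ for some $n \ge 0$ and some $p$-permutation module $W$ all of whose indecomposable direct summands have non-Sylow vertices. It is capped if it has an indecomposable direct summand whose vertex is a Sylow $p$-subgroup of $G$. Two Dade modules $M$, $N$ are compatible if $M \oplus N$ is a Dade module. Compatibility is an equivalence relation on capped Dade modules, and the set $D(G)$ of its classes is an abelian group under $[M] + [N] = [M \otimes_k N]$, with neutral element $[k]$ and $-[M] = [M^*]$. For a $G$-set $X$, let $\Delta(X)$ be the kernel of the augmentation map $kX \to k$, $x \mapsto 1$. If $X^S = \emptyset$, then $\Delta(X)$ is a capped Dade module, and we put $\Omega_X = [\Delta(X)]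 \in D(G)$. Let $D^\Omega(G)$ be the subgroup of $D(G)$ generated by all $\Omega_X$, with $X$ running over all $G$-sets with $X^S = \emptyset$. Proposition. Let $\mathcal{F}_G$ be the family of all $p$-subgroups of $G$ that are not Sylow $p$-subgroups, and let $\mathcal{F}_G/G$ be the set of $G$-conjugacy classes in $\mathcal{F}_G$. For $P \in \mathcal{F}_G$, the element $\Omega_{G/P}$ depends only on the $G$-conjugacy class $[P]$ of $P$, and the finite set $\{\Omega_{G/P} \mid [P] \in \mathcal{F}_G/G\}$ generates $D^\Omega(G)$. -/

import Mathlib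

universe u

namespace DadeGroup

open Representation

section Basic

variable {k G V W U : Type u} [Field k] [Group G]
  [AddCommGroup V] [Module k V] [AddCommGroup W] [Module k W] [AddCommGroup U] [Module k U]

/-- `ρ ∣ σ`: the module `ρ` is (isomorphic to) a direct summand of `σ`. -/
def IsSummand (ρ : Representation k G V) (σ : Representation k G W) : Prop :=
  ∃ (i : ρ.IntertwiningMap σ) (r : σ.IntertwiningMap ρ), r.comp i = IntertwiningMap.id ρ

/-- Indecomposable modules: nonzero, and not the direct sum of two nonzero submodules. -/
def IsIndecomposable (ρ : Representation k G V) : Prop :=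
  Nontrivial V ∧ ∀ A B : Subrepresentation ρ, IsCompl A B → A = ⊥ ∨ B = ⊥

/-- `H` is a vertex of `ρ`: it is minimal among the subgroups `K` such that `ρ` is a direct
summand of `Ind_K^G Res^G_K ρ`. -/
def IsVertex (H : Subgroup G) (ρ : Representation k G V) : Prop :=
  Minimal (fun K : Subgroup G => IsSummand ρ (Representation.ind K.subtype (ρ.comp K.subtype))) H

/-- The Sylow `p`-subgroups are vertices of `ρ`. -/
def HasSylowVertex (p : ℕ) (ρ : Representation k G V) : Prop :=
  ∃ S : Sylow p G, IsVertex (S : Subgroup G) ρ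

/-- `p`-permutation modules: direct summands of permutation modules `kX`, `X` a finite `G`-set. -/
def IsPPermutation (ρ : Representation k G V) : Prop :=
  ∃ (X : Type u) (_ : Finite X) (_ : MulAction G X), IsSummand ρ (ofMulAction k G X)

/-- No component (indecomposable direct summand) of `ρ` has a Sylow `p`-subgroup as a vertex. -/
def NoSylowVertexComponent (p : ℕ) (ρ : Representation k G V) : Prop :=
  ∀ U : Rep.{u} k G, IsIndecomposable U.ρ → IsSummand U.ρ ρ → ¬ HasSylowVertex p U.ρ

/-- `ρ ≅ kⁿ ⊕ W` with `W` a `p`-permutation module without Sylow-vertex components. -/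
def IsSylowVertexTrivial (p : ℕ) (ρ : Representation k G V) : Prop :=
  ∃ (n : ℕ) (W : Rep.{u} k G), IsPPermutation W.ρ ∧ NoSylowVertexComponent p W.ρ ∧
    Nonempty (ρ.Equiv ((trivial k G (Fin n → k)).prod W.ρ))

/-- Dade modules: finitely generated modules `M` with `End_k(M) ≅ kⁿ ⊕ W`, where `W` is a
`p`-permutation module all of whose components have non-Sylow vertices. -/
def IsDade (p : ℕ) (ρ : Representation k G V) : Prop :=
  Module.Finite k V ∧ IsSylowVertexTrivial p (linHom ρ ρ)

/-- A module is capped if it has a component whose vertex is a Sylow `p`-subgroup. -/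
def IsCapped (p : ℕ) (ρ : Representation k G V) : Prop :=
  ∃ U : Rep.{u} k G, IsIndecomposable U.ρ ∧ IsSummand U.ρ ρ ∧ HasSylowVertex p U.ρ

/-- Dade modules `M`, `N` are compatible if `M ⊕ N` is a Dade module. -/
def Compatible (p : ℕ) (ρ : Representation k G V) (σ : Representation k G W) : Prop :=
  IsDade p (ρ.prod σ)

/-- `X^S = ∅` for the Sylow `p`-subgroups `S` of `G` (these being conjugate, for one or for all
of them). -/
def NoSylowFixedPoint (p : ℕ) (G X : Type u) [Group G] [MulAction G X] : Prop :=
  ∀ S : Sylow p G, MulAction.fixedPoints (S : Subgroup G) X = ∅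

/-! ### Direct summands -/

lemma IsSummand.refl (ρ : Representation k G V) : IsSummand ρ ρ := ⟨.id ρ, .id ρ, rfl⟩

lemma IsSummand.trans {ρ : Representation k G V} {σ : Representation k G W}
    {τ : Representation k G U} : IsSummand ρ σ → IsSummand σ τ → IsSummand ρ τ := by
  rintro ⟨i, r, h⟩ ⟨j, s, h'⟩
  refine ⟨j.comp i, r.comp s, ?_⟩
  ext v
  have h1 := DFunLike.congr_fun h v
  have h2 := DFunLike.congr_fun h' (i v)
  simp at h1 h2 ⊢
  rw [h2, h1]

lemma IsSummand.of_equiv {ρ : Representation k G V} {σ : Representation k G W}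
    (e : ρ.Equiv σ) : IsSummand ρ σ :=
  ⟨e.toIntertwiningMap, e.symm.toIntertwiningMap, by ext v; simp⟩

lemma IsSummand.of_inv {ρ : Representation k G V} {σ : Representation k G W}
    (i : V →ₗ[k] W) (r : W →ₗ[k] V) (hi : ∀ g v, i (ρ g v) = σ g (i v))
    (hr : ∀ g w, r (σ g w) = ρ g (r w)) (h : ∀ v, r (i v) = v) : IsSummand ρ σ :=
  ⟨⟨i, fun g => by ext; simp [hi]⟩, ⟨r, fun g => by ext; simp [hr]⟩, by ext v; exact h v⟩

lemma IsSummand.inl (ρ : Representation k G V) (σ : Representation k G W) :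
    IsSummand ρ (ρ.prod σ) := ⟨.inl k ρ σ, .fst k ρ σ, by simp⟩

lemma IsSummand.inr (ρ : Representation k G V) (σ : Representation k G W) :
    IsSummand σ (ρ.prod σ) := ⟨.inr k ρ σ, .snd k ρ σ, by simp⟩

/-! ### The ideal of maps that are projective relative to the non-Sylow `p`-subgroups -/

/-- Sums of traces from stabilizers of a `G`-set without Sylow-fixed points. -/
def InIdeal (p : ℕ) (ρ : Representation k G V) (σ : Representation k G W) (f : V →ₗ[k] W) : Prop :=
  ∃ (X : Type u) (_ : Fintype X) (_ : MulAction G X) (θ : X → V →ₗ[k] W),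
    NoSylowFixedPoint p G X ∧ (∀ (g : G) (x : X), θ (g • x) = linHom ρ σ g (θ x)) ∧ ∑ x, θ x = f

variable {p : ℕ} {ρ : Representation k G V} {σ : Representation k G W} {τ : Representation k G U}

lemma noSylowFixedPoint_iff {X : Type u} [MulAction G X] :
    NoSylowFixedPoint p G X ↔ ∀ (S : Sylow p G) (x : X), ¬ ∀ s ∈ S, s • x = x := by
  refine forall_congr' fun S => ?_
  rw [Set.eq_empty_iff_forall_notMem]
  refine forall_congr' fun x => ?_
  rw [MulAction.mem_fixedPoints, not_iff_not]
  exact ⟨fun h s hs => h ⟨s, hs⟩, fun h s => h s.1 s.2⟩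

lemma InIdeal.zero : InIdeal p ρ σ 0 :=
  ⟨PEmpty, inferInstance,
    { smul := fun _ x => x, one_smul := fun x => x.elim, mul_smul := fun _ _ x => x.elim },
    fun x => x.elim, fun _ => Set.eq_empty_of_isEmpty _, fun _ x => x.elim, by simp⟩

lemma InIdeal.add {f f' : V →ₗ[k] W} (h : InIdeal p ρ σ f) (h' : InIdeal p ρ σ f') :
    InIdeal p ρ σ (f + f') := by
  obtain ⟨X, _, _, θ, h1, h2, rfl⟩ := h
  obtain ⟨Y, _, _, θ', h1', h2', rfl⟩ := h'
  rw [noSylowFixedPoint_iff] at h1 h1'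
  refine ⟨X ⊕ Y, inferInstance, inferInstance, Sum.elim θ θ', noSylowFixedPoint_iff.2 ?_, ?_, ?_⟩
  · rintro S (x | x) hx
    · exact h1 S x fun s hs => Sum.inl_injective (hx s hs)
    · exact h1' S x fun s hs => Sum.inr_injective (hx s hs)
  · rintro g (x | x)
    · exact h2 g x
    · exact h2' g x
  · simp

/-- Transport along a linear map of Hom-representations. -/
lemma InIdeal.map {V' W' : Type u} [AddCommGroup V'] [Module k V'] [AddCommGroup W'] [Module k W']
    {ρ' : Representation k G V'} {σ' : Representation k G W'} {f : V →ₗ[k] W}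
    (h : InIdeal p ρ σ f) (F : (V →ₗ[k] W) →+ (V' →ₗ[k] W'))
    (hF : ∀ g f, F (linHom ρ σ g f) = linHom ρ' σ' g (F f)) : InIdeal p ρ' σ' (F f) := by
  obtain ⟨X, _, _, θ, h1, h2, rfl⟩ := h
  exact ⟨X, inferInstance, inferInstance, fun x => F (θ x), h1, fun g x => by simp only [h2, hF],
    by rw [map_sum]⟩

lemma InIdeal.comp_left {f : V →ₗ[k] W} (h : InIdeal p ρ σ f) (a : σ.IntertwiningMap τ) :
    InIdeal p ρ τ (a.toLinearMap ∘ₗ f) :=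
  h.map (AddMonoidHom.mk' (fun f => a.toLinearMap ∘ₗ f) fun x y => by simp [LinearMap.comp_add])
    fun g f => by ext; simp [a.isIntertwining]

lemma InIdeal.comp_right {f : V →ₗ[k] W} (h : InIdeal p ρ σ f) (a : τ.IntertwiningMap ρ) :
    InIdeal p τ σ (f ∘ₗ a.toLinearMap) :=
  h.map (AddMonoidHom.mk' (fun f => f ∘ₗ a.toLinearMap) fun x y => by simp [LinearMap.add_comp])
    fun g f => by ext; simp [a.isIntertwining]

lemma InIdeal.neg {f : V →ₗ[k] W} (h : InIdeal p ρ σ f) : InIdeal p ρ σ (-f) :=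
  h.map (AddMonoidHom.mk' (fun f => -f) fun x y => by abel) fun g f => by ext; simp

/-- Relative projectivity passes to direct summands. -/
lemma InIdeal.summand (h : InIdeal p σ σ LinearMap.id) (hs : IsSummand ρ σ) :
    InIdeal p ρ ρ LinearMap.id := by
  obtain ⟨i, r, hir⟩ := hs
  have := (h.comp_left r).comp_right i
  have h2 : (r.toLinearMap ∘ₗ LinearMap.id) ∘ₗ i.toLinearMap = LinearMap.id :=
    congrArg IntertwiningMap.toLinearMap hir
  rwa [h2] at this

/-- Maps in the ideal are equivariant. -/
lemma InIdeal.equivariant {f : V →ₗ[k] W} (h : InIdeal p ρ σ f) (g : G) :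
    linHom ρ σ g f = f := by
  obtain ⟨X, _, _, θ, h1, h2, rfl⟩ := h
  rw [map_sum]
  simp_rw [← h2]
  exact Fintype.sum_equiv (MulAction.toPerm g) _ _ fun x => rfl

/-- A function on a `G`-set without Sylow-fixed points that is constant on orbits has sum `0`. -/
lemma sum_eq_zero_of_noSylowFixedPoint [Finite G] [Fact p.Prime] [CharP k p] {X : Type u} [Fintype X] [MulAction G X]
    (hX : NoSylowFixedPoint p G X) (c : X → V) (hc : ∀ (g : G) x, c (g • x) = c x) :
    ∑ x, c x = 0 := by
  classical
  obtain ⟨S⟩ : Nonempty (Sylow p G) := inferInstance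
  rw [← Finset.sum_fiberwise_of_maps_to (s := Finset.univ) (t := Finset.univ.image c) (g := c)
    (fun x hx => Finset.mem_image_of_mem _ hx)]
  refine Finset.sum_eq_zero fun a _ => ?_
  rw [Finset.sum_congr rfl (g := fun _ => a) (by simp), Finset.sum_const]
  let Y : SubMulAction (S : Subgroup G) X :=
    { carrier := {x | c x = a}
      smul_mem' := fun s x hx => by
        exact (hc s x).trans hx }
  have h1 : Nat.card Y ≡ Nat.card (MulAction.fixedPoints (S : Subgroup G) Y) [MOD p] :=
    S.isPGroup'.card_modEq_card_fixedPoints Y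
  have h2 : IsEmpty (MulAction.fixedPoints (S : Subgroup G) Y) := by
    refine ⟨fun y => ?_⟩
    have : (y.1 : X) ∈ MulAction.fixedPoints (S : Subgroup G) X := by
      rw [MulAction.mem_fixedPoints]
      intro s
      exact congrArg Subtype.val (MulAction.mem_fixedPoints.1 y.2 s)
    rw [hX S] at this
    exact this
  rw [Nat.card_of_isEmpty (α := MulAction.fixedPoints (S : Subgroup G) Y)] at h1
  have h3 : Nat.card Y = (Finset.univ.filter fun x => c x = a).card := by
    rw [← Nat.card_eq_finsetCard]
    exact Nat.card_congr (Equiv.subtypeEquivRight fun x => by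
      rw [Finset.mem_filter]; exact ⟨fun h => ⟨Finset.mem_univ _, h⟩, fun h => h.2⟩)
  rw [← h3, ← Nat.cast_smul_eq_nsmul k]
  rw [(CharP.cast_eq_zero_iff k p _).2 ((Nat.modEq_zero_iff_dvd).1 h1), zero_smul]

end Basic

section Higman

variable {k G V W U : Type u} [Field k] [Group G]
  [AddCommGroup V] [Module k V] [AddCommGroup W] [Module k W] [AddCommGroup U] [Module k U]
variable {p : ℕ} {ρ : Representation k G V} {σ : Representation k G W} {τ : Representation k G U}

lemma InIdeal.trivial_eq_zero [Finite G] [Fact p.Prime] [CharP k p] {f : V →ₗ[k] W}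
    (h : InIdeal p (trivial k G V) (trivial k G W) f) : f = 0 := by
  obtain ⟨X, _, _, θ, h1, h2, rfl⟩ := h
  refine sum_eq_zero_of_noSylowFixedPoint (k := k) h1 θ fun g x => ?_
  rw [h2]
  ext
  simp

lemma InIdeal.finrank_eq_zero [Finite G] [Fact p.Prime] [CharP k p] [Module.Finite k V]
    (h : InIdeal p ρ ρ LinearMap.id) : (Module.finrank k V : k) = 0 := by
  obtain ⟨X, _, _, θ, h1, h2, h3⟩ := h
  rw [← LinearMap.trace_id, ← h3, map_sum]
  refine sum_eq_zero_of_noSylowFixedPoint (k := k) h1 (fun x => LinearMap.trace k V (θ x)) fun g x => ?_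
  simp only [h2, linHom_apply]
  rw [LinearMap.trace_comp_comm', LinearMap.comp_assoc]
  congr 1
  ext
  simp

/-- The coset decomposition of an induced module. -/
lemma ind_decomposition [Finite G] (H : Subgroup G) (ρ : Representation k G V) [Fintype (G ⧸ H)] :
    ∃ (J : G ⧸ H → V →ₗ[k] IndV H.subtype (ρ.comp H.subtype))
      (s : G ⧸ H → IndV H.subtype (ρ.comp H.subtype) →ₗ[k] V),
      (∀ (g : G) q v, Representation.ind H.subtype (ρ.comp H.subtype) g (J q v)
        = J (g • q) (ρ g v)) ∧
      (∀ (g : G) q x, s (g • q) (Representation.ind H.subtype (ρ.comp H.subtype) g x)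
        = ρ g (s q x)) ∧
      (∀ q v, s q (J q v) = v) ∧ (∀ q q' v, q ≠ q' → s q (J q' v) = 0) ∧
      ∀ x, ∑ q, J q (s q x) = x := by
  classical
  let J₀ : G → V →ₗ[k] IndV H.subtype (ρ.comp H.subtype) := fun g =>
    IndV.mk H.subtype (ρ.comp H.subtype) g⁻¹ ∘ₗ ρ g⁻¹
  have hJ₀ : ∀ (g : G) (h : H), J₀ (g * h) = J₀ g := by
    intro g h
    ext v
    have := Coinvariants.mk_self_apply
      (tprod ((leftRegular k G).comp H.subtype) (ρ.comp H.subtype)) h⁻¹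
      (TensorProduct.tmul k (MonoidAlgebra.single g⁻¹ 1) (ρ g⁻¹ v))
    simpa [J₀] using this
  have hJ₁ : ∀ g g' : G, (g : G ⧸ H) = g' → J₀ g = J₀ g' := by
    intro g g' h
    rw [QuotientGroup.eq] at h
    have := hJ₀ g ⟨_, h⟩
    simpa using this.symm
  let s : G ⧸ H → IndV H.subtype (ρ.comp H.subtype) →ₗ[k] V := fun q =>
    Coinvariants.lift _ (TensorProduct.lift
      ((Finsupp.lift _ _ _ fun h : G => if ((h⁻¹ : G) : G ⧸ H) = q then ρ h⁻¹ else 0) ∘ₗ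
      (MonoidAlgebra.coeffLinearEquiv k).toLinearMap)) (by
        intro h
        ext g v
        have : (((h * g)⁻¹ : G) : G ⧸ H) = ((g⁻¹ : G) : G ⧸ H) := by
          rw [QuotientGroup.eq]; simp
        simp
        split_ifs <;> simp)
  have hs : ∀ q (h : G) v, s q (IndV.mk H.subtype (ρ.comp H.subtype) h v) =
      if ((h⁻¹ : G) : G ⧸ H) = q then ρ h⁻¹ v else 0 := by
    intro q h v
    simp [s]
    split_ifs <;> simp
  have hsJ : ∀ q (g : G) v, s q (J₀ g v) = if (g : G ⧸ H) = q then v else 0 := by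
    intro q g v
    refine (hs q g⁻¹ (ρ g⁻¹ v)).trans ?_
    simp
  have hmk : ∀ (h : G) v, IndV.mk H.subtype (ρ.comp H.subtype) h v = J₀ h⁻¹ (ρ h⁻¹ v) := by
    intro h v
    simp [J₀]
  have hext : ∀ {E : Type u} [AddCommGroup E] [Module k E]
      (a b : IndV H.subtype (ρ.comp H.subtype) →ₗ[k] E),
      (∀ g v, a (J₀ g v) = b (J₀ g v)) → a = b := by
    intro E _ _ a b hab
    refine IndV.hom_ext _ _ fun h => LinearMap.ext fun v => ?_
    change a (IndV.mk H.subtype (ρ.comp H.subtype) h v) =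
      b (IndV.mk H.subtype (ρ.comp H.subtype) h v)
    rw [hmk, hab]
  have hind : ∀ (g g' : G) v, Representation.ind H.subtype (ρ.comp H.subtype) g (J₀ g' v) =
      J₀ (g * g') (ρ g v) := by
    intro g g' v
    simp [J₀]
  have hout : ∀ (g : G) (q : G ⧸ H), ((g * q.out : G) : G ⧸ H) = g • q := by
    intro g q
    rw [← smul_eq_mul, MulAction.Quotient.coe_smul_out]
  refine ⟨fun q => J₀ q.out, s, ?_, ?_, ?_, ?_, ?_⟩
  · intro g q v
    rw [hind]
    exact DFunLike.congr_fun (hJ₁ _ _ (by rw [hout]; simp)) _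
  · intro g q x
    suffices h : s (g • q) ∘ₗ Representation.ind H.subtype (ρ.comp H.subtype) g = ρ g ∘ₗ s q from
      DFunLike.congr_fun h x
    refine hext _ _ fun h v => ?_
    change s (g • q) (Representation.ind H.subtype (ρ.comp H.subtype) g (J₀ h v)) =
      ρ g (s q (J₀ h v))
    rw [hind, hsJ, hsJ, ← smul_eq_mul,
      ← MulAction.Quotient.smul_coe]
    simp only [smul_left_cancel_iff]
    split_ifs <;> simp
  · intro q v
    simp [hsJ]
  · intro q q' v hq
    simp [hsJ, hq.symm]
  · intro x
    suffices h : ∑ q : G ⧸ H, J₀ q.out ∘ₗ s q = LinearMap.id by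
      simpa using DFunLike.congr_fun h x
    refine hext _ _ fun h v => ?_
    simp only [LinearMap.comp_apply, LinearMap.sum_apply, hsJ, LinearMap.id_apply]
    rw [Finset.sum_eq_single (h : G ⧸ H)]
    · rw [if_pos rfl]
      exact DFunLike.congr_fun (hJ₁ _ _ (by simp)) _
    · intro q _ hq
      rw [if_neg hq.symm, map_zero]
    · simp

end Higman

section Higman2

variable {k G V W U : Type u} [Field k] [Group G]
  [AddCommGroup V] [Module k V] [AddCommGroup W] [Module k W] [AddCommGroup U] [Module k U]
variable {p : ℕ} {ρ : Representation k G V} {σ : Representation k G W} {τ : Representation k G U}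

lemma noSylowFixedPoint_quotient [Finite G] [Fact p.Prime] {H : Subgroup G}
    (h : ∀ S : Sylow p G, ¬ (S : Subgroup G) ≤ H) : NoSylowFixedPoint p G (G ⧸ H) := by
  rw [noSylowFixedPoint_iff]
  intro S x hx
  induction x using QuotientGroup.induction_on with
  | H g =>
    refine h (g⁻¹ • S) fun y hy => ?_
    rw [Sylow.coe_subgroup_smul, Subgroup.mem_pointwise_smul_iff_inv_smul_mem] at hy
    have h1 := hx _ hy
    rw [MulAction.Quotient.smul_coe, QuotientGroup.eq] at h1
    have h2 := H.inv_mem h1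
    simpa [mul_assoc] using h2

lemma isSummand_ind_of_isUnit [Finite G] {H : Subgroup G} [Fintype (G ⧸ H)]
    (θ : G ⧸ H → Module.End k V) (hθ : ∀ (g : G) q, θ (g • q) = linHom ρ ρ g (θ q))
    (hu : IsUnit (∑ q, θ q)) :
    IsSummand ρ (Representation.ind H.subtype (ρ.comp H.subtype)) := by
  obtain ⟨J, s, hJ, hs, hsJ, hsJ', hsum⟩ := ind_decomposition H ρ
  obtain ⟨u, hu⟩ := hu
  have hcomm : ∀ (g : G) v, (∑ q, θ q) (ρ g v) = ρ g ((∑ q, θ q) v) := by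
    intro g v
    rw [LinearMap.sum_apply, LinearMap.sum_apply, map_sum]
    refine (Fintype.sum_equiv (MulAction.toPerm g) _ _ fun q => ?_).symm
    simp [hθ]
  have hcomm' : ∀ (g : G) v, (↑u⁻¹ : Module.End k V) (ρ g v) = ρ g ((↑u⁻¹ : Module.End k V) v) := by
    intro g v
    have h1 : ∀ w, (↑u⁻¹ : Module.End k V) ((∑ q, θ q) w) = w := fun w => by
      rw [← hu]; exact DFunLike.congr_fun u.inv_mul w
    have h2 : ∀ w, (∑ q, θ q) ((↑u⁻¹ : Module.End k V) w) = w := fun w => by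
      rw [← hu]; exact DFunLike.congr_fun u.mul_inv w
    rw [← h1 (ρ g ((↑u⁻¹ : Module.End k V) v)), hcomm, h2]
  refine IsSummand.of_inv (∑ q, J q ∘ₗ θ q) ((↑u⁻¹ : Module.End k V) ∘ₗ ∑ q, s q) ?_ ?_ ?_
  · intro g v
    rw [LinearMap.sum_apply, LinearMap.sum_apply, map_sum]
    refine (Fintype.sum_equiv (MulAction.toPerm g) _ _ fun q => ?_).symm
    simp only [MulAction.toPerm_apply, hθ, LinearMap.comp_apply, linHom_apply, inv_self_apply, hJ]
  · intro g x
    rw [LinearMap.comp_apply, LinearMap.comp_apply, ← hcomm']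
    congr 1
    rw [LinearMap.sum_apply, LinearMap.sum_apply, map_sum]
    refine (Fintype.sum_equiv (MulAction.toPerm g) _ _ fun q => ?_).symm
    exact (hs g q x).symm
  · intro v
    have : (∑ q, s q) ((∑ q, J q ∘ₗ θ q) v) = (∑ q, θ q) v := by
      rw [LinearMap.sum_apply, LinearMap.sum_apply, LinearMap.sum_apply]
      refine Finset.sum_congr rfl fun q _ => ?_
      rw [map_sum, Finset.sum_eq_single q]
      · simp [hsJ]
      · intro q' _ hq
        exact hsJ' _ _ _ hq.symm
      · simp
    rw [LinearMap.comp_apply, this, ← hu]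
    exact DFunLike.congr_fun u.inv_mul v

lemma inIdeal_of_isSummand_ind [Finite G] [Fact p.Prime] {H : Subgroup G}
    (h : ∀ S : Sylow p G, ¬ (S : Subgroup G) ≤ H)
    (hs : IsSummand ρ (Representation.ind H.subtype (ρ.comp H.subtype))) :
    InIdeal p ρ ρ LinearMap.id := by
  have := Fintype.ofFinite (G ⧸ H)
  obtain ⟨J, s, hJ, hs', -, -, hsum⟩ := ind_decomposition H ρ
  refine InIdeal.summand ?_ hs
  refine ⟨G ⧸ H, inferInstance, inferInstance, fun q => J q ∘ₗ s q,
    noSylowFixedPoint_quotient h, ?_, ?_⟩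
  · intro g q
    refine LinearMap.ext fun x => ?_
    simp only [LinearMap.comp_apply, linHom_apply, hJ]
    rw [← hs' g q, self_inv_apply]
  · refine LinearMap.ext fun x => ?_
    simpa using hsum x

lemma subrepresentation_isCompl_iff {A B : Subrepresentation ρ} :
    IsCompl A B ↔ IsCompl A.toSubmodule B.toSubmodule := by
  rw [isCompl_iff, isCompl_iff, disjoint_iff, disjoint_iff, codisjoint_iff, codisjoint_iff,
    ← Subrepresentation.toSubmodule_injective.eq_iff,
    ← Subrepresentation.toSubmodule_injective.eq_iff]
  rfl

/-- Fitting's lemma. -/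
lemma isUnit_or_isNilpotent [Module.Finite k V] (h : IsIndecomposable ρ) (f : Module.End k V)
    (hf : ∀ g, Commute f (ρ g)) : IsUnit f ∨ IsNilpotent f := by
  obtain ⟨n, hn, hn0⟩ := (LinearMap.eventually_isCompl_ker_pow_range_pow f |>.and
    (Filter.eventually_ge_atTop 1)).exists
  have hfn : ∀ (g : G) v, (f ^ n) (ρ g v) = ρ g ((f ^ n) v) := fun g v =>
    DFunLike.congr_fun ((hf g).pow_left n).eq v
  let A : Subrepresentation ρ := ⟨LinearMap.ker (f ^ n), fun g v hv => by
    rw [LinearMap.mem_ker] at hv ⊢; rw [hfn, hv, map_zero]⟩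
  let B : Subrepresentation ρ := ⟨LinearMap.range (f ^ n), fun g v hv => by
    obtain ⟨w, rfl⟩ := hv; exact ⟨ρ g w, hfn g w⟩⟩
  rcases h.2 A B (subrepresentation_isCompl_iff.2 hn) with hA | hB
  · left
    have h1 : LinearMap.ker (f ^ n) = ⊥ := congrArg Subrepresentation.toSubmodule hA
    have h2 : IsUnit (f ^ n) := LinearMap.isUnit_iff_ker_eq_bot _ |>.2 h1
    exact (isUnit_pow_iff (by omega)).1 h2
  · right
    have h1 : LinearMap.range (f ^ n) = ⊥ := congrArg Subrepresentation.toSubmodule hB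
    exact ⟨n, LinearMap.range_eq_bot.1 h1⟩

lemma exists_isUnit [Module.Finite k V] (h : IsIndecomposable ρ) {ι : Type*} (s : Finset ι)
    (f : ι → Module.End k V) (hf : ∀ i g, Commute (f i) (ρ g))
    (hu : IsUnit (∑ i ∈ s, f i)) : ∃ i ∈ s, IsUnit (f i) := by
  classical
  have := h.1
  induction s using Finset.induction_on with
  | empty => simp at hu
  | insert a s ha ih =>
    rw [Finset.sum_insert ha] at hu
    by_contra! hcon
    have hs : ¬ IsUnit (∑ i ∈ s, f i) := fun hs => by
      obtain ⟨i, hi, hi'⟩ := ih hs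
      exact hcon i (Finset.mem_insert_of_mem hi) hi'
    have hsc : ∀ g, Commute (∑ i ∈ s, f i) (ρ g) := fun g =>
      Commute.sum_left _ _ _ fun i _ => hf i g
    obtain ⟨u, hu⟩ := hu
    have huc : ∀ g, Commute (↑u⁻¹ : Module.End k V) (ρ g) := fun g =>
      Commute.units_inv_left (by rw [hu]; exact (hf a g).add_left (hsc g))
    rcases isUnit_or_isNilpotent h (↑u⁻¹ * f a) (fun g => (huc g).mul_left (hf a g)) with h1 | h1
    · exact hcon a (Finset.mem_insert_self _ _) ((Units.isUnit_units_mul _ _).1 h1)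
    · have h2 : 1 - ↑u⁻¹ * f a = ↑u⁻¹ * ∑ i ∈ s, f i := by
        rw [sub_eq_iff_eq_add, ← mul_add, add_comm, ← hu, Units.inv_mul]
      have h3 := h1.isUnit_one_sub
      rw [h2] at h3
      exact hs ((Units.isUnit_units_mul _ _).1 h3)

/-- A module that is projective relative to the non-Sylow `p`-subgroups has no Sylow vertex. -/
lemma not_hasSylowVertex [Finite G] [Fact p.Prime] [CharP k p] [Module.Finite k V]
    (h : IsIndecomposable ρ) (hI : InIdeal p ρ ρ LinearMap.id) : ¬ HasSylowVertex p ρ := by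
  classical
  rintro ⟨S, hS⟩
  obtain ⟨X, _, _, θ, hX, hθ, hsum⟩ := hI
  have := Fintype.ofFinite (G ⧸ (S : Subgroup G))
  obtain ⟨i, r, hir⟩ := hS.prop
  obtain ⟨J, s, hJ, hs, -, -, hJs⟩ := ind_decomposition (S : Subgroup G) ρ
  let η : G ⧸ (S : Subgroup G) → Module.End k V := fun q =>
    r.toLinearMap ∘ₗ J q ∘ₗ s q ∘ₗ i.toLinearMap
  have hη : ∀ (g : G) q, η (g • q) = linHom ρ ρ g (η q) := by
    intro g q
    refine LinearMap.ext fun v => ?_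
    simp only [η, LinearMap.comp_apply, linHom_apply, IntertwiningMap.toLinearMap_apply]
    rw [← r.isIntertwining, hJ, ← hs, ← i.isIntertwining, self_inv_apply]
  have hηsum : ∑ q, η q = 1 := by
    refine LinearMap.ext fun v => ?_
    simp only [η, LinearMap.sum_apply, LinearMap.comp_apply, ← map_sum, hJs]
    exact DFunLike.congr_fun hir v
  let Y := (G ⧸ (S : Subgroup G)) × X
  let ψ : Y → Module.End k V := fun y => η y.1 * θ y.2
  have hψ : ∀ (g : G) y, ψ (g • y) = linHom ρ ρ g (ψ y) := by
    intro g y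
    refine LinearMap.ext fun v => ?_
    obtain ⟨c, x⟩ := y
    change η (g • c) (θ (g • x) v) = ρ g (η c (θ x (ρ g⁻¹ v)))
    rw [hη, hθ]
    simp only [linHom_apply, LinearMap.comp_apply, inv_self_apply]
  have hψsum : ∑ y, ψ y = 1 := by
    rw [Fintype.sum_prod_type]
    simp only [ψ, ← Finset.mul_sum, ← Finset.sum_mul]
    rw [hηsum, hsum]
    rfl
  let q : Y → MulAction.orbitRel.Quotient G Y := Quotient.mk _
  have hfib : ∑ ω : MulAction.orbitRel.Quotient G Y, ∑ y with q y = ω, ψ y = 1 := by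
    rw [← hψsum]
    exact Finset.sum_fiberwise _ _ _
  have hq : ∀ (g : G) y, q (g • y) = q y := fun g y =>
    Quotient.sound (MulAction.orbitRel_apply.2 ⟨g, rfl⟩)
  obtain ⟨ω, -, hω⟩ := exists_isUnit h Finset.univ (fun ω => ∑ y with q y = ω, ψ y) (by
    intro ω g
    have h1 : linHom ρ ρ g (∑ y with q y = ω, ψ y) = ∑ y with q y = ω, ψ y := by
      rw [map_sum]
      simp_rw [← hψ]
      exact Finset.sum_equiv (MulAction.toPerm g) (by simp [hq]) fun y _ => rfl
    refine LinearMap.ext fun v => ?_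
    nth_rewrite 1 [← h1]
    simp only [linHom_apply, Module.End.mul_apply, LinearMap.comp_apply, inv_self_apply]) (by rw [hfib]; exact isUnit_one)
  obtain ⟨x, rfl⟩ : ∃ x : X, q (((1 : G) : G ⧸ (S : Subgroup G)), x) = ω := by
    induction ω using Quotient.inductionOn with
    | h y =>
      obtain ⟨c, x⟩ := y
      induction c using QuotientGroup.induction_on with
      | H g =>
        refine ⟨g⁻¹ • x, ?_⟩
        rw [← hq g]
        change q (_, _) = q (_, _)
        simp
  set y : Y := (((1 : G) : G ⧸ (S : Subgroup G)), x) with hy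
  let P := MulAction.stabilizer G y
  have hPS : P ≤ S := by
    intro g hg
    have h1 := congrArg Prod.fst (MulAction.mem_stabilizer_iff.1 hg)
    have h2 : ((g * 1 : G) : G ⧸ (S : Subgroup G)) = ((1 : G) : G ⧸ (S : Subgroup G)) := h1
    rw [QuotientGroup.eq] at h2
    simpa using h2
  have hP : IsSummand ρ (Representation.ind P.subtype (ρ.comp P.subtype)) := by
    have := Fintype.ofFinite (G ⧸ P)
    refine isSummand_ind_of_isUnit (fun c => ψ (MulAction.ofQuotientStabilizer G y c)) ?_ ?_
    · intro g c
      rw [MulAction.ofQuotientStabilizer_smul, hψ]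
    · convert hω using 1
      refine Finset.sum_bij (fun c _ => MulAction.ofQuotientStabilizer G y c) ?_ ?_ ?_ ?_
      · intro c _
        obtain ⟨g, hg⟩ := MulAction.ofQuotientStabilizer_mem_orbit G y c
        simp only [Finset.mem_filter, Finset.mem_univ, true_and]
        rw [← hg]
        exact hq g y
      · intro c _ c' _ hc
        exact MulAction.injective_ofQuotientStabilizer G y hc
      · intro z hz
        rw [Finset.mem_filter] at hz
        obtain ⟨g, hg⟩ := MulAction.orbitRel_apply.1 (Quotient.exact hz.2)
        exact ⟨(g : G ⧸ P), Finset.mem_univ _, hg⟩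
      · intro c _
        rfl
  have hSP : (S : Subgroup G) ≤ P := hS.2 hP hPS
  exact (noSylowFixedPoint_iff.1 hX S x) fun s hs => (Prod.ext_iff.1 (hSP hs)).2

/-- An indecomposable module without Sylow vertex is projective relative to the non-Sylow
`p`-subgroups. -/
lemma inIdeal_of_not_hasSylowVertex [Finite G] [Fact p.Prime] [CharP k p]
    (h : ¬ HasSylowVertex p ρ) : InIdeal p ρ ρ LinearMap.id := by
  obtain ⟨S⟩ : Nonempty (Sylow p G) := inferInstance
  have hS : IsSummand ρ
      (Representation.ind (S : Subgroup G).subtype (ρ.comp (S : Subgroup G).subtype)) := by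
    have := Fintype.ofFinite (G ⧸ (S : Subgroup G))
    refine isSummand_ind_of_isUnit (fun _ => 1) ?_ ?_
    · intro g q
      refine LinearMap.ext fun v => ?_
      simp
    · rw [Finset.sum_const, ← Nat.cast_smul_eq_nsmul k, Finset.card_univ, ← Nat.card_eq_fintype_card]
      have h1 : ((Nat.card (G ⧸ (S : Subgroup G)) : ℕ) : k) ≠ 0 := by
        rw [Ne, CharP.cast_eq_zero_iff k p]
        exact S.not_dvd_index
      rw [Module.End.isUnit_iff]
      exact (LinearEquiv.smulOfNeZero k V _ h1).bijective
  have h1 : ¬ IsVertex (S : Subgroup G) ρ := fun h' => h ⟨S, h'⟩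
  obtain ⟨H, hH, hHS⟩ : ∃ H : Subgroup G,
      IsSummand ρ (Representation.ind H.subtype (ρ.comp H.subtype)) ∧ H < S := by
    by_contra! hcon
    exact h1 ⟨hS, fun K hK hKS => by
      by_contra hSK
      exact hcon K hK (lt_of_le_not_ge hKS hSK)⟩
  refine inIdeal_of_isSummand_ind (fun T hT => ?_) hH
  have h2 := T.is_maximal' S.isPGroup' (hT.trans hHS.le)
  exact hHS.not_ge (h2.le.trans hT)

lemma NoSylowVertexComponent.summand (h : NoSylowVertexComponent p σ) (hs : IsSummand ρ σ) :
    NoSylowVertexComponent p ρ := fun U hU hUρ => h U hU (hUρ.trans hs)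

lemma projectionOnto_comm {A B : Subrepresentation ρ}
    (h : IsCompl A.toSubmodule B.toSubmodule) (g : G) (w : V) :
    A.toSubmodule.projectionOnto B.toSubmodule h (ρ g w) =
      A.toRepresentation g (A.toSubmodule.projectionOnto B.toSubmodule h w) := by
  have hw : w ∈ A.toSubmodule ⊔ B.toSubmodule := by rw [h.sup_eq_top]; trivial
  obtain ⟨a, ha, b, hb, rfl⟩ := Submodule.mem_sup.1 hw
  rw [map_add, map_add, map_add, map_add,
    Submodule.projectionOnto_apply_of_mem_left h (A.apply_mem_toSubmodule g ha),
    Submodule.projectionOnto_apply_of_mem_left h ha,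
    (Submodule.projectionOnto_apply_eq_zero_iff h).2 hb,
    (Submodule.projectionOnto_apply_eq_zero_iff h).2 (B.apply_mem_toSubmodule g hb), map_zero]
  rfl

lemma isSummand_of_isCompl {A B : Subrepresentation ρ}
    (h : IsCompl A.toSubmodule B.toSubmodule) : IsSummand A.toRepresentation ρ :=
  IsSummand.of_inv A.toSubmodule.subtype (A.toSubmodule.projectionOnto B.toSubmodule h)
    (fun _ _ => rfl) (projectionOnto_comm h) (fun v => by simp)

lemma InIdeal.of_isCompl {A B : Subrepresentation ρ}
    (h : IsCompl A.toSubmodule B.toSubmodule)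
    (hA : InIdeal p A.toRepresentation A.toRepresentation LinearMap.id) :
    InIdeal p ρ ρ (A.toSubmodule.projection B.toSubmodule h) := by
  have := (hA.comp_left (⟨A.toSubmodule.subtype, fun g => rfl⟩ :
    A.toRepresentation.IntertwiningMap ρ)).comp_right
    (⟨A.toSubmodule.projectionOnto B.toSubmodule h, fun g =>
      LinearMap.ext fun w => projectionOnto_comm h g w⟩ : ρ.IntertwiningMap A.toRepresentation)
  exact this

/-- A module is projective relative to the non-Sylow `p`-subgroups if and only if it has no
Sylow-vertex component. -/
lemma noSylowVertexComponent_iff [Finite G] [Fact p.Prime] [CharP k p] [Module.Finite k V] :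
    NoSylowVertexComponent p ρ ↔ InIdeal p ρ ρ LinearMap.id := by
  constructor
  · suffices H : ∀ (n : ℕ) (U : Rep.{u} k G), Module.Finite k U → Module.finrank k U ≤ n →
        NoSylowVertexComponent p U.ρ → InIdeal p U.ρ U.ρ LinearMap.id from
      H _ (Rep.of ρ) ‹_› le_rfl
    intro n
    induction n with
    | zero => 
      intro U _ hn _
      have : Subsingleton U := Module.finrank_zero_iff.1 (Nat.le_zero.1 hn)
      rw [Subsingleton.elim (LinearMap.id : U →ₗ[k] U) 0]
      exact InIdeal.zero
    | succ n ih =>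
      intro U _ hn hU
      by_cases hI : IsIndecomposable U.ρ
      · exact inIdeal_of_not_hasSylowVertex (hU U hI (IsSummand.refl _))
      · rw [IsIndecomposable, not_and_or] at hI
        rcases hI with hI | hI
        · rw [not_nontrivial_iff_subsingleton] at hI
          rw [Subsingleton.elim (LinearMap.id : U →ₗ[k] U) 0]
          exact InIdeal.zero
        · push Not at hI
          obtain ⟨A, B, hAB, hA, hB⟩ := hI
          replace hAB := subrepresentation_isCompl_iff.1 hAB
          have hdim := Submodule.finrank_add_eq_of_isCompl hAB
          have key : ∀ C : Subrepresentation U.ρ, C ≠ ⊥ → 0 < Module.finrank k C.toSubmodule := by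
            intro C hC
            rw [Nat.pos_iff_ne_zero, Ne, Submodule.finrank_eq_zero]
            exact fun h => hC (Subrepresentation.toSubmodule_injective h)
          have hA1 := ih (Rep.of A.toRepresentation) inferInstance
            (by have := key B hB; change Module.finrank k A.toSubmodule ≤ n; omega)
            (hU.summand (isSummand_of_isCompl hAB))
          have hB1 := ih (Rep.of B.toRepresentation) inferInstance
            (by have := key A hA; change Module.finrank k B.toSubmodule ≤ n; omega)
            (hU.summand (isSummand_of_isCompl hAB.symm))
          have h1 := (hA1.of_isCompl hAB).add (hB1.of_isCompl hAB.symm)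
          convert h1 using 1
          refine LinearMap.ext fun w => ?_
          simpa using (Submodule.projection_add_projection_eq_self hAB w).symm
  · intro h U hU hUρ
    obtain ⟨i, r, hir⟩ := id hUρ
    have : Module.Finite k U := Module.Finite.of_injective i.toLinearMap
      (Function.LeftInverse.injective (g := r) fun v => DFunLike.congr_fun hir v)
    exact not_hasSylowVertex hU (h.summand hUρ)

end Higman2

section Trivial

variable {k G V W U : Type u} [Field k] [Group G]
  [AddCommGroup V] [Module k V] [AddCommGroup W] [Module k W] [AddCommGroup U] [Module k U]
variable {p : ℕ} {ρ : Representation k G V} {σ : Representation k G W} {τ : Representation k G U}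

/-! ### Closure properties of `p`-permutation modules -/

lemma IsPPermutation.of_basis {X : Type u} [Finite X] [MulAction G X] (b : Module.Basis X k V)
    (hb : ∀ (g : G) x, ρ g (b x) = b (g • x)) : IsPPermutation ρ := by
  refine ⟨X, inferInstance, inferInstance, IsSummand.of_equiv (Representation.Equiv.mk
    (b.repr ≪≫ₗ (MonoidAlgebra.coeffLinearEquiv k).symm) fun g => b.ext fun x => ?_)⟩
  have h : ∀ y, (b.repr ≪≫ₗ (MonoidAlgebra.coeffLinearEquiv k).symm) (b y) =
      MonoidAlgebra.single y (1 : k) := fun y => by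
    simp only [LinearEquiv.trans_apply, Module.Basis.repr_self]; rfl
  simp only [LinearMap.comp_apply, LinearEquiv.coe_coe, hb, h, ofMulAction_single]

/-- The permutation basis of `kX`. -/
noncomputable def permBasis (k X : Type u) [Field k] : Module.Basis X k (MonoidAlgebra k X) :=
  Module.Basis.ofRepr (MonoidAlgebra.coeffLinearEquiv k)

lemma permBasis_apply (X : Type u) (x : X) : permBasis k X x = MonoidAlgebra.single x 1 := rfl

lemma IsPPermutation.finite (h : IsPPermutation ρ) : Module.Finite k V := by
  obtain ⟨X, _, _, i, r, hir⟩ := h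
  have : Module.Finite k (MonoidAlgebra k X) := Module.Finite.of_basis (permBasis k X)
  exact Module.Finite.of_injective i.toLinearMap
      (Function.LeftInverse.injective (g := r) fun v => DFunLike.congr_fun hir v)

lemma IsPPermutation.summand (h : IsPPermutation σ) (hs : IsSummand ρ σ) : IsPPermutation ρ := by
  obtain ⟨X, _, _, h⟩ := h
  exact ⟨X, inferInstance, inferInstance, hs.trans h⟩

lemma IsSummand.prod {V' W' : Type u} [AddCommGroup V'] [Module k V'] [AddCommGroup W'] [Module k W']
    {ρ' : Representation k G V'} {σ' : Representation k G W'} (h : IsSummand ρ ρ')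
    (h' : IsSummand σ σ') : IsSummand (ρ.prod σ) (ρ'.prod σ') := by
  obtain ⟨i, r, hir⟩ := h
  obtain ⟨j, s, hjs⟩ := h'
  refine IsSummand.of_inv (i.toLinearMap.prodMap j.toLinearMap) (r.toLinearMap.prodMap s.toLinearMap)
    (fun g v => ?_) (fun g v => ?_) (fun v => ?_)
  · exact Prod.ext (i.isIntertwining ..) (j.isIntertwining ..)
  · exact Prod.ext (r.isIntertwining ..) (s.isIntertwining ..)
  · exact Prod.ext (DFunLike.congr_fun hir v.1) (DFunLike.congr_fun hjs v.2)

lemma IsSummand.tprod {V' W' : Type u} [AddCommGroup V'] [Module k V'] [AddCommGroup W'] [Module k W']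
    {ρ' : Representation k G V'} {σ' : Representation k G W'} (h : IsSummand ρ ρ')
    (h' : IsSummand σ σ') : IsSummand (ρ.tprod σ) (ρ'.tprod σ') := by
  obtain ⟨i, r, hir⟩ := h
  obtain ⟨j, s, hjs⟩ := h'
  refine ⟨i.tensor j, r.tensor s, IntertwiningMap.ext (TensorProduct.ext' fun v w => ?_)⟩
  have h1 := DFunLike.congr_fun hir v
  have h2 := DFunLike.congr_fun hjs w
  simp only [IntertwiningMap.comp_apply, IntertwiningMap.id_apply] at h1 h2
  simp [h1, h2]

/-- The map `f ↦ j ∘ f ∘ r` on Hom-spaces. -/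
def homMap {V' W' : Type u} [AddCommGroup V'] [Module k V'] [AddCommGroup W'] [Module k W']
    (r : V' →ₗ[k] V) (j : W →ₗ[k] W') : (V →ₗ[k] W) →ₗ[k] (V' →ₗ[k] W') where
  toFun f := j ∘ₗ f ∘ₗ r
  map_add' f f' := by ext; simp
  map_smul' c f := by ext; simp

@[simp]
lemma homMap_apply {V' W' : Type u} [AddCommGroup V'] [Module k V'] [AddCommGroup W'] [Module k W']
    (r : V' →ₗ[k] V) (j : W →ₗ[k] W') (f : V →ₗ[k] W) (v : V') : homMap r j f v = j (f (r v)) := rfl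

lemma IsSummand.linHom {V' W' : Type u} [AddCommGroup V'] [Module k V'] [AddCommGroup W']
    [Module k W'] {ρ' : Representation k G V'} {σ' : Representation k G W'} (h : IsSummand ρ ρ')
    (h' : IsSummand σ σ') : IsSummand (ρ.linHom σ) (ρ'.linHom σ') := by
  obtain ⟨i, r, hir⟩ := h
  obtain ⟨j, s, hjs⟩ := h'
  refine IsSummand.of_inv (homMap r.toLinearMap j.toLinearMap)
    (homMap i.toLinearMap s.toLinearMap)
    (fun g f => ?_) (fun g f => ?_) (fun f => ?_)
  · ext v; simp [r.isIntertwining, j.isIntertwining]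
  · ext v; simp [i.isIntertwining, s.isIntertwining]
  · ext v
    have h1 := DFunLike.congr_fun hir v
    have h2 := DFunLike.congr_fun hjs (f v)
    simp only [IntertwiningMap.comp_apply, IntertwiningMap.id_apply] at h1 h2
    simp [h1, h2]

lemma IsPPermutation.prod (h : IsPPermutation ρ) (h' : IsPPermutation σ) :
    IsPPermutation (ρ.prod σ) := by
  obtain ⟨X, _, _, h⟩ := h
  obtain ⟨Y, _, _, h'⟩ := h'
  refine IsPPermutation.summand ?_ (h.prod h')
  refine IsPPermutation.of_basis ((permBasis k X).prod (permBasis k Y)) ?_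
  rintro g (x | y)
  · simp [permBasis_apply]
  · simp [permBasis_apply]

lemma IsPPermutation.tprod (h : IsPPermutation ρ) (h' : IsPPermutation σ) :
    IsPPermutation (ρ.tprod σ) := by
  obtain ⟨X, _, _, h⟩ := h
  obtain ⟨Y, _, _, h'⟩ := h'
  refine IsPPermutation.summand ?_ (h.tprod h')
  refine IsPPermutation.of_basis ((permBasis k X).tensorProduct (permBasis k Y)) ?_
  rintro g ⟨x, y⟩
  simp [permBasis_apply]

lemma isPPermutation_trivial [Module.Finite k V] : IsPPermutation (trivial k G V) := by
  let b := Module.finBasis k V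
  let _ : MulAction G (ULift.{u} (Fin (Module.finrank k V))) :=
    { smul := fun _ x => x, one_smul := fun _ => rfl, mul_smul := fun _ _ _ => rfl }
  exact IsPPermutation.of_basis (b.reindex Equiv.ulift.symm) fun g x => rfl

lemma IsPPermutation.dual (h : IsPPermutation ρ) : IsPPermutation (linHom ρ (trivial k G k)) := by
  classical
  obtain ⟨X, _, _, h⟩ := h
  refine IsPPermutation.summand ?_ (h.linHom (IsSummand.refl _))
  have := Fintype.ofFinite X
  refine IsPPermutation.of_basis (permBasis k X).dualBasis ?_
  intro g x
  refine (permBasis k X).ext fun y => ?_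
  simp only [linHom_apply, LinearMap.comp_apply, permBasis_apply, ofMulAction_single]
  rw [← permBasis_apply, ← permBasis_apply, Module.Basis.dualBasis_apply_self,
    Module.Basis.dualBasis_apply_self]
  simp [inv_smul_eq_iff]

/-! ### Sylow-vertex triviality modulo the ideal -/

/-- The identity factors through a trivial module modulo the ideal. -/
def InTriv (p : ℕ) (ρ : Representation k G V) : Prop :=
  ∃ (T : Type u) (_ : AddCommGroup T) (_ : Module k T) (_ : Module.Finite k T)
    (a : ρ.IntertwiningMap (trivial k G T)) (b : (trivial k G T).IntertwiningMap ρ),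
    InIdeal p ρ ρ (LinearMap.id - b.toLinearMap ∘ₗ a.toLinearMap)

lemma InTriv.summand (h : InTriv p σ) (hs : IsSummand ρ σ) : InTriv p ρ := by
  obtain ⟨T, _, _, _, a, b, h⟩ := h
  obtain ⟨i, r, hir⟩ := hs
  refine ⟨T, inferInstance, inferInstance, inferInstance, a.comp i, r.comp b, ?_⟩
  convert (h.comp_left r).comp_right i using 1
  ext v
  have h1 := DFunLike.congr_fun hir v
  simp only [IntertwiningMap.comp_apply, IntertwiningMap.id_apply] at h1
  simp [h1]

lemma InTriv.prod (h : InTriv p ρ) (h' : InTriv p σ) : InTriv p (ρ.prod σ) := by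
  obtain ⟨T, _, _, _, a, b, h⟩ := h
  obtain ⟨T', _, _, _, a', b', h'⟩ := h'
  refine ⟨T × T', inferInstance, inferInstance, inferInstance,
    ⟨a.toLinearMap.prodMap a'.toLinearMap, fun g => ?_⟩,
    ⟨b.toLinearMap.prodMap b'.toLinearMap, fun g => ?_⟩, ?_⟩
  · ext v <;> simp [a.isIntertwining, a'.isIntertwining]
  · refine LinearMap.ext fun v => ?_
    simp [← b.isIntertwining, ← b'.isIntertwining]
  · convert ((h.comp_left (.inl k ρ σ)).comp_right (.fst k ρ σ)).add
      ((h'.comp_left (.inr k ρ σ)).comp_right (.snd k ρ σ)) using 1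
    refine LinearMap.ext fun v => ?_
    refine Prod.ext ?_ ?_ <;>
    simp [IntertwiningMap.inl, IntertwiningMap.inr, IntertwiningMap.prod, IntertwiningMap.fst,
      IntertwiningMap.snd]

lemma InIdeal.tensor_left {f : Module.End k V} (h : InIdeal p ρ ρ f) (a : σ.IntertwiningMap σ) :
    InIdeal p (ρ.tprod σ) (ρ.tprod σ) (TensorProduct.map f a.toLinearMap) :=
  h.map (AddMonoidHom.mk' (fun f => TensorProduct.map f a.toLinearMap)
    fun x y => TensorProduct.map_add_left ..) fun g f => TensorProduct.ext' fun v w => by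
      simp [← a.isIntertwining]

lemma InIdeal.tensor_right {f : Module.End k W} (h : InIdeal p σ σ f) (a : ρ.IntertwiningMap ρ) :
    InIdeal p (ρ.tprod σ) (ρ.tprod σ) (TensorProduct.map a.toLinearMap f) :=
  h.map (AddMonoidHom.mk' (fun f => TensorProduct.map a.toLinearMap f)
    fun x y => TensorProduct.map_add_right ..) fun g f => TensorProduct.ext' fun v w => by
      simp [← a.isIntertwining]

lemma InTriv.tprod (h : InTriv p ρ) (h' : InTriv p σ) : InTriv p (ρ.tprod σ) := by
  obtain ⟨T, _, _, _, a, b, h⟩ := h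
  obtain ⟨T', _, _, _, a', b', h'⟩ := h'
  refine ⟨TensorProduct k T T', inferInstance, inferInstance, inferInstance,
    ⟨TensorProduct.map a.toLinearMap a'.toLinearMap, fun g => ?_⟩,
    ⟨TensorProduct.map b.toLinearMap b'.toLinearMap, fun g => ?_⟩, ?_⟩
  · refine TensorProduct.ext' fun v w => ?_
    simp [a.isIntertwining, a'.isIntertwining]
  · refine TensorProduct.ext' fun v w => ?_
    simp [← b.isIntertwining, ← b'.isIntertwining]
  · convert (h.tensor_left (.id σ)).add (h'.tensor_right (b.comp a)) using 1
    refine TensorProduct.ext' fun v w => ?_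
    simp [TensorProduct.sub_tmul, TensorProduct.tmul_sub]

lemma InIdeal.homMap_left {f : Module.End k W} (h : InIdeal p σ σ f) :
    InIdeal p (linHom ρ σ) (linHom ρ σ) (homMap LinearMap.id f) :=
  h.map (AddMonoidHom.mk' (fun f => homMap LinearMap.id f)
    fun x y => by ext; simp) fun g f => by ext; simp

lemma InIdeal.homMap_right {f : Module.End k V} (h : InIdeal p ρ ρ f) :
    InIdeal p (linHom ρ σ) (linHom ρ σ) (homMap f LinearMap.id) :=
  h.map (AddMonoidHom.mk' (fun f => homMap f LinearMap.id)
    fun x y => by ext; simp) fun g f => by ext; simp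

lemma InTriv.dual (h : InTriv p ρ) : InTriv p (linHom ρ (trivial k G k)) := by
  obtain ⟨T, _, _, _, a, b, h⟩ := h
  refine ⟨Module.Dual k T, inferInstance, inferInstance, inferInstance,
    ⟨homMap b.toLinearMap LinearMap.id, fun g => ?_⟩,
    ⟨homMap a.toLinearMap LinearMap.id, fun g => ?_⟩, ?_⟩
  · ext f t
    simp [← b.isIntertwining]
  · ext f t
    simp [a.isIntertwining]
  · convert h.homMap_right (σ := trivial k G k) using 1
    ext
    simp

end Trivial

section Characterization

variable {k G V W U : Type u} [Field k] [Group G]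
  [AddCommGroup V] [Module k V] [AddCommGroup W] [Module k W] [AddCommGroup U] [Module k U]
variable {p : ℕ} {ρ : Representation k G V} {σ : Representation k G W} {τ : Representation k G U}

lemma inTriv_trivial [Module.Finite k V] : InTriv p (trivial k G V) :=
  ⟨V, inferInstance, inferInstance, inferInstance, .id _, .id _, by
    convert InIdeal.zero using 1
    ext; simp⟩

lemma InIdeal.inTriv (h : InIdeal p ρ ρ LinearMap.id) : InTriv p ρ :=
  ⟨PUnit, inferInstance, inferInstance, inferInstance, 0, 0, by
    convert h using 1
    ext; simp⟩

lemma isSylowVertexTrivial_of_split [Finite G] [Fact p.Prime] [CharP k p]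
    (hp : IsPPermutation ρ) {n : ℕ} (f : ρ.IntertwiningMap (trivial k G (Fin n → k)))
    (g : (trivial k G (Fin n → k)).IntertwiningMap ρ) (hfg : ∀ c, f (g c) = c)
    (h : InIdeal p ρ ρ (LinearMap.id - g.toLinearMap ∘ₗ f.toLinearMap)) :
    IsSylowVertexTrivial p ρ := by
  have := hp.finite
  have hf : ∀ (x : G) v, f (ρ x v) = f v := fun x v => by simp [f.isIntertwining]
  have hg : ∀ (x : G) c, ρ x (g c) = g c := fun x v => by simp [← g.isIntertwining]
  let A : Subrepresentation ρ := ⟨LinearMap.ker f.toLinearMap, fun x v hv => by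
    have hv' : f v = 0 := hv
    exact (hf x v).trans hv'⟩
  have hA : ∀ v, v ∈ A.toSubmodule ↔ f v = 0 := fun v => Iff.rfl
  let π : V →ₗ[k] A.toSubmodule := LinearMap.codRestrict _
    (LinearMap.id - g.toLinearMap ∘ₗ f.toLinearMap) fun v => by
      rw [hA]; simp [hfg]
  have hπ : ∀ v, (π v : V) = v - g (f v) := fun v => rfl
  have hπρ : ∀ (x : G) v, π (ρ x v) = A.toRepresentation x (π v) := fun x v => by
    apply Subtype.ext
    change _ = ρ x (π v : V)
    rw [hπ, hπ, map_sub, hf, hg]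
  have hs : IsSummand A.toRepresentation ρ :=
    IsSummand.of_inv A.toSubmodule.subtype π (fun _ _ => rfl) hπρ fun v => by
      apply Subtype.ext
      have : f (v : V) = 0 := v.2
      rw [hπ]; simp [this]
  refine ⟨n, Rep.of A.toRepresentation, hp.summand hs, ?_, ⟨Representation.Equiv.mk
    { toFun := fun v => (f v, π v)
      invFun := fun c => g c.1 + c.2.1
      map_add' := fun v w => by simp
      map_smul' := fun c v => by simp
      left_inv := fun v => by simp [hπ]
      right_inv := fun c => ?_ } fun x => ?_⟩⟩
  · have : Module.Finite k (Rep.of A.toRepresentation) := (hp.summand hs).finite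
    rw [noSylowVertexComponent_iff]
    have h1 := (h.comp_left (⟨π, fun x => LinearMap.ext (hπρ x)⟩ :
      ρ.IntertwiningMap A.toRepresentation)).comp_right
      (⟨A.toSubmodule.subtype, fun x => rfl⟩ : A.toRepresentation.IntertwiningMap ρ)
    convert h1 using 1
    refine LinearMap.ext fun v => Subtype.ext ?_
    have : f (v : V) = 0 := v.2
    simp [hπ, this]
  · have h1 : f c.2.1 = 0 := c.2.2
    refine Prod.ext ?_ (Subtype.ext ?_)
    · simp [hfg, h1]
    · simp [hπ, hfg, h1]
  · refine LinearMap.ext fun v => Prod.ext ?_ ?_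
    · exact hf x v
    · exact hπρ x v

/-- The definition of Sylow-vertex trivial modules in terms of the ideal. -/
lemma isSylowVertexTrivial_iff [Finite G] [Fact p.Prime] [CharP k p] :
    IsSylowVertexTrivial p ρ ↔ IsPPermutation ρ ∧ InTriv p ρ := by
  constructor
  · rintro ⟨n, W, hW, hW', ⟨e⟩⟩
    have := hW.finite
    rw [noSylowVertexComponent_iff] at hW'
    exact ⟨(isPPermutation_trivial.prod hW).summand (.of_equiv e),
      (inTriv_trivial.prod hW'.inTriv).summand (.of_equiv e)⟩
  · rintro ⟨hp, T, _, _, _, a, b, h⟩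
    have := hp.finite
    have h1 := (h.comp_left a).comp_right b
    have hA : ∀ x, a (b (a (b x))) = a (b x) := fun x => by
      have := DFunLike.congr_fun h1.trivial_eq_zero x
      simp [sub_eq_zero] at this
      exact this.symm
    let A : T →ₗ[k] T := a.toLinearMap ∘ₗ b.toLinearMap
    let e := (Module.finBasis k (LinearMap.range A)).equivFun
    have ha : ∀ (x : G) v, a (ρ x v) = a v := fun x v => by simp [a.isIntertwining]
    have hb : ∀ (x : G) c, ρ x (b c) = b c := fun x v => by simp [← b.isIntertwining]
    refine isSylowVertexTrivial_of_split hp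
      ⟨e.toLinearMap ∘ₗ A.rangeRestrict ∘ₗ a.toLinearMap, fun x => ?_⟩
      ⟨b.toLinearMap ∘ₗ (LinearMap.range A).subtype ∘ₗ e.symm.toLinearMap, fun x => ?_⟩ ?_ ?_
    · refine LinearMap.ext fun v => ?_
      refine congrArg e (Subtype.ext ?_)
      exact congrArg A (ha x v)
    · refine LinearMap.ext fun v => ?_
      simp [hb]
    · intro c
      obtain ⟨⟨_, x, rfl⟩, rfl⟩ := e.surjective c
      change e (A.rangeRestrict (a (b (e.symm (e _))))) = _
      rw [LinearEquiv.symm_apply_apply]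
      congr 1
      refine Subtype.ext ?_
      change a (b (a (b (a (b x))))) = a (b x)
      simp only [hA]
    · convert h.add (h.comp_left (b.comp a)) using 1
      refine LinearMap.ext fun v => ?_
      change v - b ((e.symm (e (A.rangeRestrict (a v))) : LinearMap.range A) : T) = _
      rw [LinearEquiv.symm_apply_apply]
      change v - b (a (b (a v))) = (v - b (a v)) + b (a (v - b (a v)))
      rw [map_sub, map_sub]
      abel

variable [Finite G] [Fact p.Prime] [CharP k p]

lemma IsSylowVertexTrivial.summand (h : IsSylowVertexTrivial p σ) (hs : IsSummand ρ σ) :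
    IsSylowVertexTrivial p ρ := by
  rw [isSylowVertexTrivial_iff] at h ⊢
  exact ⟨h.1.summand hs, h.2.summand hs⟩

lemma IsSylowVertexTrivial.prod (h : IsSylowVertexTrivial p ρ) (h' : IsSylowVertexTrivial p σ) :
    IsSylowVertexTrivial p (ρ.prod σ) := by
  rw [isSylowVertexTrivial_iff] at h h' ⊢
  exact ⟨h.1.prod h'.1, h.2.prod h'.2⟩

lemma IsSylowVertexTrivial.tprod (h : IsSylowVertexTrivial p ρ) (h' : IsSylowVertexTrivial p σ) :
    IsSylowVertexTrivial p (ρ.tprod σ) := by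
  rw [isSylowVertexTrivial_iff] at h h' ⊢
  exact ⟨h.1.tprod h'.1, h.2.tprod h'.2⟩

lemma IsSylowVertexTrivial.dual (h : IsSylowVertexTrivial p ρ) :
    IsSylowVertexTrivial p (linHom ρ (trivial k G k)) := by
  rw [isSylowVertexTrivial_iff] at h ⊢
  exact ⟨h.1.dual, h.2.dual⟩

lemma isSylowVertexTrivial_trivial [Module.Finite k V] :
    IsSylowVertexTrivial p (trivial k G V) :=
  isSylowVertexTrivial_iff.2 ⟨isPPermutation_trivial, inTriv_trivial⟩

end Characterization

section Hom

variable {k G V W U L : Type u} [Field k] [Group G]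
  [AddCommGroup V] [Module k V] [AddCommGroup W] [Module k W] [AddCommGroup U] [Module k U]
  [AddCommGroup L] [Module k L]
variable {p : ℕ} {ρ : Representation k G V} {σ : Representation k G W} {τ : Representation k G U}
  {υ : Representation k G L}

/-! ### Natural isomorphisms between Hom-representations -/

lemma dual_eq (ρ : Representation k G V) : ρ.dual = linHom ρ (trivial k G k) := by
  ext g f v
  simp [Module.Dual.transpose_apply]

lemma nonempty_equiv [Module.Finite k V] [Module.Finite k W] (i : V →ₗ[k] W)
    (hi : ∀ g v, i (ρ g v) = σ g (i v)) (h0 : ∀ v, i v = 0 → v = 0)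
    (h : Module.finrank k V = Module.finrank k W) : Nonempty (ρ.Equiv σ) :=
  ⟨Representation.Equiv.mk (LinearEquiv.ofInjectiveOfFinrankEq i
    ((injective_iff_map_eq_zero i).2 h0) h) fun g => by ext v; exact hi g v⟩

lemma isSummand_of_nonempty (h : Nonempty (ρ.Equiv σ)) : IsSummand ρ σ := h.elim .of_equiv

lemma isSummand_of_nonempty_symm (h : Nonempty (ρ.Equiv σ)) : IsSummand σ ρ :=
  h.elim fun e => .of_equiv e.symm

/-- `Hom(N, M) ≅ Hom(M, N)*`. -/
lemma equiv_trace [Module.Finite k V] [Module.Finite k W] :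
    Nonempty ((linHom σ ρ).Equiv (linHom (linHom ρ σ) (trivial k G k))) := by
  refine nonempty_equiv (LinearMap.mk₂ k
    (fun (g : W →ₗ[k] V) (f : V →ₗ[k] W) => LinearMap.trace k W (f ∘ₗ g))
    (fun g g' f => by simp [LinearMap.comp_add]) (fun c g f => by simp [LinearMap.comp_smul])
    (fun g f f' => by simp [LinearMap.add_comp]) (fun c g f => by simp [LinearMap.smul_comp]))
    ?_ ?_ ?_
  · intro g f
    ext f'
    simp only [LinearMap.mk₂_apply, LinearMap.comp_apply, linHom_apply, inv_inv, isTrivial_apply]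
    exact LinearMap.trace_comp_comm' (σ g⁻¹) (f' ∘ₗ ρ g ∘ₗ f)
  · intro f hf
    ext w
    rw [LinearMap.zero_apply, ← Module.forall_dual_apply_eq_zero_iff k]
    intro φ
    have h1 := DFunLike.congr_fun hf (φ.smulRight w)
    rw [LinearMap.mk₂_apply, LinearMap.zero_apply] at h1
    rw [← h1]
    exact (LinearMap.trace_smulRight (φ ∘ₗ f) w).symm
  · simp [Module.finrank_linearMap, mul_comm]

/-- `Hom(M, N) ≅ Hom(N*, M*)`. -/
lemma equiv_transpose [Module.Finite k V] [Module.Finite k W] :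
    Nonempty ((linHom ρ σ).Equiv
      (linHom (linHom σ (trivial k G k)) (linHom ρ (trivial k G k)))) := by
  refine nonempty_equiv (V := V →ₗ[k] W) (W := (W →ₗ[k] k) →ₗ[k] (V →ₗ[k] k))
    { toFun := fun f => LinearMap.lcomp k k f
      map_add' := fun f f' => by ext; simp
      map_smul' := fun c f => by ext; simp } ?_ ?_ ?_
  · intro g f
    ext φ v
    simp
  · intro f hf
    ext v
    rw [LinearMap.zero_apply, ← Module.forall_dual_apply_eq_zero_iff k]
    intro φ
    exact DFunLike.congr_fun (DFunLike.congr_fun hf φ) v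
  · simp [Module.finrank_linearMap, mul_comm]

/-- `Hom(M ⊗ N, M' ⊗ N') ≅ Hom(M, M') ⊗ Hom(N, N')`. -/
lemma equiv_homTensorHom [Module.Finite k V] [Module.Finite k W] [Module.Finite k U]
    [Module.Finite k L] :
    Nonempty (((linHom ρ σ).tprod (linHom τ υ)).Equiv (linHom (ρ.tprod τ) (σ.tprod υ))) := by
  refine ⟨Representation.Equiv.mk (homTensorHomEquiv k V U W L) fun g => ?_⟩
  refine TensorProduct.ext' fun f f' => TensorProduct.ext' fun v w => ?_
  simp

/-- `M* ⊗ M ≅ End(M)`. -/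
lemma equiv_dualTensor [Module.Finite k V] :
    Nonempty (((linHom ρ (trivial k G k)).tprod ρ).Equiv (linHom ρ ρ)) := by
  refine ⟨Representation.Equiv.mk (dualTensorHomEquiv k V V) fun g => ?_⟩
  refine TensorProduct.ext' fun f f' => ?_
  ext v
  simp [dualTensorHomEquiv]

/-- `Hom(k, M) ≅ M`. -/
lemma equiv_homUnit : Nonempty ((linHom (trivial k G k) ρ).Equiv ρ) :=
  ⟨Representation.Equiv.mk (LinearMap.ringLmapEquivSelf k k V) fun g => by ext f; simp⟩

lemma equiv_tensorUnit : Nonempty ((ρ.tprod (trivial k G k)).Equiv ρ) :=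
  ⟨Representation.Equiv.mk (TensorProduct.rid k V) fun g => by
    refine TensorProduct.ext' fun v c => ?_
    simp⟩

lemma equiv_tensorComm : Nonempty ((ρ.tprod σ).Equiv (σ.tprod ρ)) :=
  ⟨Representation.Equiv.mk (TensorProduct.comm k V W) fun g => by
    refine TensorProduct.ext' fun v w => ?_
    simp⟩

lemma equiv_tensorAssoc : Nonempty (((ρ.tprod σ).tprod τ).Equiv (ρ.tprod (σ.tprod τ))) :=
  ⟨Representation.Equiv.mk (TensorProduct.assoc k V W U) fun g => by
    refine TensorProduct.ext_threefold fun v w x => ?_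
    simp⟩

/-- `M` is a direct summand of `End(M) ⊗ M`. -/
lemma isSummand_end_tensor : IsSummand ρ ((linHom ρ ρ).tprod ρ) :=
  IsSummand.of_inv (TensorProduct.mk k _ _ LinearMap.id) (TensorProduct.lift LinearMap.id)
    (fun g v => by
      simp only [TensorProduct.mk_apply, Representation.tprod_apply, TensorProduct.map_tmul]
      congr 1
      ext; simp)
    (fun g x => by
      induction x using TensorProduct.induction_on with
      | zero => simp
      | tmul f v => simp
      | add x y hx hy => simp only [map_add, hx, hy])
    fun v => by simp

/-! ### The Dade and compatibility conditions in terms of Hom-representations -/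

lemma isCapped_iff : IsCapped p ρ ↔ ¬ NoSylowVertexComponent p ρ := by
  simp [IsCapped, NoSylowVertexComponent]

lemma isSummand_unit_pi {n : ℕ} (hn : n ≠ 0) :
    IsSummand (trivial k G k) (trivial k G (Fin n → k)) := by
  have i : Fin n := ⟨0, Nat.pos_of_ne_zero hn⟩
  exact IsSummand.of_inv (LinearMap.single k (fun _ => k) i)
    (LinearMap.proj i) (fun _ _ => rfl) (fun _ _ => rfl) fun v => by simp

variable [Finite G] [Fact p.Prime] [CharP k p]

lemma IsSylowVertexTrivial.symm [Module.Finite k V] [Module.Finite k W]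
    (h : IsSylowVertexTrivial p (linHom ρ σ)) : IsSylowVertexTrivial p (linHom σ ρ) :=
  h.dual.summand (isSummand_of_nonempty equiv_trace)

lemma compatible_iff (h : IsDade p ρ) (h' : IsDade p σ) :
    Compatible p ρ σ ↔ IsSylowVertexTrivial p (linHom ρ σ) := by
  have := h.1
  have := h'.1
  constructor
  · intro hc
    exact hc.2.summand ((IsSummand.inl _ _).linHom (IsSummand.inr _ _))
  · intro hc
    refine ⟨inferInstance, ((h.2.prod hc).prod (hc.symm.prod h'.2)).summand ?_⟩
    refine IsSummand.of_inv
      { toFun := fun f => ((LinearMap.fst k V W ∘ₗ f ∘ₗ LinearMap.inl k V W,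
          LinearMap.snd k V W ∘ₗ f ∘ₗ LinearMap.inl k V W),
          (LinearMap.fst k V W ∘ₗ f ∘ₗ LinearMap.inr k V W,
          LinearMap.snd k V W ∘ₗ f ∘ₗ LinearMap.inr k V W))
        map_add' := fun f f' => by simp [LinearMap.add_comp, LinearMap.comp_add]
        map_smul' := fun c f => by simp [LinearMap.smul_comp, LinearMap.comp_smul] }
      { toFun := fun f => LinearMap.coprod (LinearMap.prod f.1.1 f.1.2)
          (LinearMap.prod f.2.1 f.2.2)
        map_add' := fun f f' => by ext <;> simp
        map_smul' := fun c f => by ext <;> simp } ?_ ?_ ?_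
    · intro g f
      refine Prod.ext (Prod.ext ?_ ?_) (Prod.ext ?_ ?_) <;> ext v <;> simp
    · intro g f
      ext v <;> simp
    · intro f
      ext v <;> simp

/-- A Dade module `M` is capped exactly if the trivial module divides `End(M)`. -/
lemma isCapped_iff_unit (h : IsDade p ρ) :
    IsCapped p ρ ↔ IsSummand (trivial k G k) (linHom ρ ρ) := by
  have := h.1
  rw [isCapped_iff, noSylowVertexComponent_iff]
  constructor
  · intro hc
    obtain ⟨n, W, hW, hW', ⟨e⟩⟩ := h.2
    by_cases hn : n = 0
    · refine absurd ?_ hc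
      have := hW.finite
      rw [noSylowVertexComponent_iff] at hW'
      have h1 : IsSummand (linHom ρ ρ) W.ρ := by
        refine (IsSummand.of_equiv e).trans (IsSummand.of_inv (LinearMap.snd k _ _)
          (LinearMap.inr k _ _) (fun _ _ => rfl) (fun g v => ?_) fun v => ?_)
        · simp
        · subst hn
          exact Prod.ext (Subsingleton.elim _ _) rfl
      have h2 := (hW'.summand h1).tensor_left (.id ρ)
      refine InIdeal.summand ?_ isSummand_end_tensor
      convert h2 using 1
      exact (TensorProduct.map_id).symm
    · exact (isSummand_unit_pi hn).trans ((IsSummand.inl _ _).trans (.of_equiv e.symm))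
  · intro hs hI
    have h1 := hI.homMap_left (ρ := ρ)
    have h2 : InIdeal p (linHom ρ ρ) (linHom ρ ρ) LinearMap.id := by
      convert h1 using 1
      ext; simp
    have h3 := (h2.summand hs).trivial_eq_zero
    exact one_ne_zero (DFunLike.congr_fun h3 (1 : k))

lemma IsSylowVertexTrivial.trans [Module.Finite k V] [Module.Finite k W] [Module.Finite k U]
    (hs : IsSummand (trivial k G k) (linHom σ σ))
    (h : IsSylowVertexTrivial p (linHom ρ σ)) (h' : IsSylowVertexTrivial p (linHom σ τ)) :
    IsSylowVertexTrivial p (linHom ρ τ) := by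
  refine (h.tprod h').summand ?_
  have h1 : IsSummand (linHom ρ τ) ((linHom ρ τ).tprod (linHom σ σ)) :=
    (isSummand_of_nonempty_symm equiv_tensorUnit).trans ((IsSummand.refl _).tprod hs)
  refine h1.trans ((isSummand_of_nonempty equiv_homTensorHom).trans
    (IsSummand.trans ?_ (isSummand_of_nonempty_symm equiv_homTensorHom)))
  exact (IsSummand.refl _).linHom (isSummand_of_nonempty equiv_tensorComm)

lemma isCapped_and_isDade_iff : IsDade p ρ ∧ IsCapped p ρ ↔ Module.Finite k V ∧
    IsSylowVertexTrivial p (linHom ρ ρ) ∧ IsSummand (trivial k G k) (linHom ρ ρ) := by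
  constructor
  · rintro ⟨h, h'⟩
    exact ⟨h.1, h.2, (isCapped_iff_unit h).1 h'⟩
  · rintro ⟨h1, h2, h3⟩
    exact ⟨⟨h1, h2⟩, (isCapped_iff_unit ⟨h1, h2⟩).2 h3⟩

lemma capped_trivial : IsDade p (trivial k G k) ∧ IsCapped p (trivial k G k) := by
  rw [isCapped_and_isDade_iff]
  exact ⟨inferInstance, isSylowVertexTrivial_trivial.summand (isSummand_of_nonempty equiv_homUnit),
    isSummand_of_nonempty_symm equiv_homUnit⟩

lemma capped_tprod (h : IsDade p ρ ∧ IsCapped p ρ) (h' : IsDade p σ ∧ IsCapped p σ) :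
    IsDade p (ρ.tprod σ) ∧ IsCapped p (ρ.tprod σ) := by
  rw [isCapped_and_isDade_iff] at h h' ⊢
  obtain ⟨_, h2, h3⟩ := h
  obtain ⟨_, h2', h3'⟩ := h'
  refine ⟨inferInstance, (h2.tprod h2').summand (isSummand_of_nonempty_symm equiv_homTensorHom),
    ?_⟩
  exact (isSummand_of_nonempty_symm equiv_tensorUnit).trans
    ((h3.tprod h3').trans (isSummand_of_nonempty equiv_homTensorHom))

lemma capped_dual (h : IsDade p ρ ∧ IsCapped p ρ) :
    IsDade p ρ.dual ∧ IsCapped p ρ.dual := by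
  rw [isCapped_and_isDade_iff] at h ⊢
  obtain ⟨_, h2, h3⟩ := h
  rw [dual_eq]
  exact ⟨inferInstance, h2.summand (isSummand_of_nonempty_symm equiv_transpose),
    h3.trans (isSummand_of_nonempty equiv_transpose)⟩

lemma compatible_of_equiv (h : IsDade p ρ) (h' : IsDade p σ) (e : Nonempty (ρ.Equiv σ)) :
    Compatible p ρ σ :=
  (compatible_iff h h').2 (h.2.summand
    ((IsSummand.refl _).linHom (isSummand_of_nonempty_symm e)))

end Hom

section Relative

variable {k G V W U L : Type u} [Field k] [Group G]
variable {p : ℕ}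

/-! ### Relative syzygies -/

/-- The augmentation `kX → k`, sending every `x ∈ X` to `1`. -/
noncomputable def augmentation (k X : Type u) [Field k] : MonoidAlgebra k X →ₗ[k] k :=
  (permBasis k X).constr k fun _ => (1 : k)

lemma augmentation_basis (X : Type u) (x : X) : augmentation k X (permBasis k X x) = 1 := by
  simp [augmentation]

lemma perm_basis_smul (X : Type u) [MulAction G X] (g : G) (x : X) :
    ofMulAction k G X g (permBasis k X x) = permBasis k X (g • x) := by
  simp [permBasis_apply]

lemma augmentation_smul (X : Type u) [MulAction G X] (g : G) (v : MonoidAlgebra k X) :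
    augmentation k X (ofMulAction k G X g v) = augmentation k X v := by
  have : augmentation k X ∘ₗ ofMulAction k G X g = augmentation k X :=
    (permBasis k X).ext fun x => by
      rw [LinearMap.comp_apply, perm_basis_smul, augmentation_basis, augmentation_basis]
  exact DFunLike.congr_fun this v

/-- The relative syzygy module `Δ(X)`, the kernel of the augmentation, as a submodule of `kX`. -/
noncomputable def syzygy (k G X : Type u) [Field k] [Group G] [MulAction G X] :
    Subrepresentation (ofMulAction k G X) where
  toSubmodule := LinearMap.ker (augmentation k X)
  apply_mem_toSubmodule g v hv := (augmentation_smul X g v).trans hv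

/-- The module `Δ(X)`. -/
noncomputable abbrev Δ (k G X : Type u) [Field k] [Group G] [MulAction G X] :
    Representation k G (syzygy k G X).toSubmodule :=
  (syzygy k G X).toRepresentation

variable {X : Type u} [MulAction G X]

lemma inIdeal_perm [Finite X] (hX : NoSylowFixedPoint p G X) :
    InIdeal p (ofMulAction k G X) (ofMulAction k G X) LinearMap.id := by
  classical
  have := Fintype.ofFinite X
  refine ⟨X, inferInstance, inferInstance,
    fun x => ((permBasis k X).coord x).smulRight (permBasis k X x), hX, ?_, ?_⟩
  · intro g x
    refine (permBasis k X).ext fun y => ?_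
    simp only [linHom_apply, LinearMap.comp_apply, perm_basis_smul, LinearMap.smulRight_apply,
      Module.Basis.coord_apply, Module.Basis.repr_self, map_smul]
    congr 1
    simp [Finsupp.single_apply, inv_smul_eq_iff]
  · refine (permBasis k X).ext fun y => ?_
    simp [Finsupp.single_apply]

lemma perm_finite [Finite X] : Module.Finite k (MonoidAlgebra k X) :=
  Module.Finite.of_basis (permBasis k X)

lemma isPPermutation_perm [Finite X] : IsPPermutation (ofMulAction k G X) :=
  ⟨X, inferInstance, inferInstance, .refl _⟩

/-- For `c : kX → k`, the diagonal endomorphism `x ↦ c(x) x` of `kX`. -/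
noncomputable def diag (k X : Type u) [Field k] :
    (MonoidAlgebra k X →ₗ[k] k) →ₗ[k] (MonoidAlgebra k X →ₗ[k] MonoidAlgebra k X) where
  toFun c := (permBasis k X).constr k fun x => c (permBasis k X x) • permBasis k X x
  map_add' c c' := (permBasis k X).ext fun x => by simp [add_smul]
  map_smul' a c := (permBasis k X).ext fun x => by simp [mul_smul]

lemma diag_basis (c : MonoidAlgebra k X →ₗ[k] k) (x : X) :
    diag k X c (permBasis k X x) = c (permBasis k X x) • permBasis k X x := by
  simp [diag]

lemma diag_smul (g : G) (c : MonoidAlgebra k X →ₗ[k] k) (v : MonoidAlgebra k X) :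
    diag k X (c ∘ₗ ofMulAction k G X g⁻¹) v =
      ofMulAction k G X g (diag k X c (ofMulAction k G X g⁻¹ v)) := by
  have : diag k X (c ∘ₗ ofMulAction k G X g⁻¹) =
      ofMulAction k G X g ∘ₗ diag k X c ∘ₗ ofMulAction k G X g⁻¹ :=
    (permBasis k X).ext fun x => by
      simp only [LinearMap.comp_apply, diag_basis, perm_basis_smul, map_smul, smul_inv_smul]
  exact DFunLike.congr_fun this v

lemma augmentation_diag (c : MonoidAlgebra k X →ₗ[k] k) (v : MonoidAlgebra k X) :
    augmentation k X (diag k X c v) = c v := by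
  have : augmentation k X ∘ₗ diag k X c = c := (permBasis k X).ext fun x => by
    simp [diag_basis, augmentation_basis]
  exact DFunLike.congr_fun this v

/-- The element `y - x` of `Δ(X)`. -/
noncomputable def diff (k G : Type u) {X : Type u} [Field k] [Group G] [MulAction G X] (y x : X) :
    (syzygy k G X).toSubmodule :=
  ⟨permBasis k X y - permBasis k X x, by
    change augmentation k X _ = 0
    rw [map_sub, augmentation_basis, augmentation_basis, sub_self]⟩

lemma diff_smul (g : G) (y x : X) : Δ k G X g (diff k G y x) = diff k G (g • y) (g • x) := by
  refine Subtype.ext ?_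
  change ofMulAction k G X g (permBasis k X y - permBasis k X x) = _
  rw [map_sub, perm_basis_smul, perm_basis_smul]
  rfl

lemma syzygy_eq_sum [Fintype X] (x₀ : X) (v : (syzygy k G X).toSubmodule) :
    v = ∑ y, (permBasis k X).repr v y • diff k G y x₀ := by
  have hv : augmentation k X v = 0 := v.2
  rw [← (permBasis k X).sum_repr (v : MonoidAlgebra k X)] at hv
  simp only [map_sum, map_smul, augmentation_basis, smul_eq_mul, mul_one] at hv
  refine Subtype.ext ?_
  rw [AddSubmonoidClass.coe_finsetSum]
  simp only [SetLike.val_smul, diff, smul_sub, Finset.sum_sub_distrib, ← Finset.sum_smul, hv,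
    zero_smul, sub_zero]
  exact ((permBasis k X).sum_repr _).symm

/-- The extension `F̃(y) = ∑ₓ Fₓ(y - x) x` of `F : Δ(X) → kX` to `kX`. -/
noncomputable def extend (k G X : Type u) [Field k] [Group G] [MulAction G X] [Fintype X] :
    ((syzygy k G X).toSubmodule →ₗ[k] MonoidAlgebra k X) →ₗ[k]
      (MonoidAlgebra k X →ₗ[k] MonoidAlgebra k X) where
  toFun F := (permBasis k X).constr k fun y =>
    ∑ x, (permBasis k X).coord x (F (diff k G y x)) • permBasis k X x
  map_add' F F' := (permBasis k X).ext fun x => by simp [add_smul, Finset.sum_add_distrib]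
  map_smul' a F := (permBasis k X).ext fun x => by 
    simp only [Module.Basis.constr_basis, LinearMap.smul_apply, map_smul, smul_eq_mul, mul_smul,
      Finset.smul_sum, RingHom.id_apply]

lemma extend_basis [Fintype X] (F : (syzygy k G X).toSubmodule →ₗ[k] MonoidAlgebra k X) (y : X) :
    extend k G X F (permBasis k X y) =
      ∑ x, (permBasis k X).coord x (F (diff k G y x)) • permBasis k X x := by
  simp only [extend, LinearMap.coe_mk, AddHom.coe_mk, Module.Basis.constr_basis]

lemma extend_smul [Fintype X] (g : G) (F : (syzygy k G X).toSubmodule →ₗ[k] MonoidAlgebra k X) :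
    extend k G X (linHom (Δ k G X) (ofMulAction k G X) g F) =
      linHom (ofMulAction k G X) (ofMulAction k G X) g (extend k G X F) := by
  refine (permBasis k X).ext fun y => ?_
  simp only [linHom_apply, LinearMap.comp_apply, perm_basis_smul, extend_basis, map_sum, map_smul,
    diff_smul]
  refine Fintype.sum_equiv (MulAction.toPerm g⁻¹) _ _ fun x => ?_
  simp only [MulAction.toPerm_apply, smul_inv_smul]
  congr 1
  generalize F (diff k G (g⁻¹ • y) (g⁻¹ • x)) = v
  have : (permBasis k X).coord x ∘ₗ ofMulAction k G X g = (permBasis k X).coord (g⁻¹ • x) := by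
    classical
    refine (permBasis k X).ext fun z => ?_
    simp [perm_basis_smul, Finsupp.single_apply, eq_inv_smul_iff]
  exact DFunLike.congr_fun this v

lemma extend_diff [Fintype X] (F : (syzygy k G X).toSubmodule →ₗ[k] MonoidAlgebra k X)
    (v : (syzygy k G X).toSubmodule) : extend k G X F v = F v := by
  obtain hX | ⟨⟨x₀⟩⟩ := isEmpty_or_nonempty X
  · have : v = 0 := Subtype.ext ((permBasis k X).ext_elem fun x => hX.elim x)
    simp [this]
  · rw [syzygy_eq_sum x₀ v, map_sum, AddSubmonoidClass.coe_finsetSum, map_sum]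
    refine Finset.sum_congr rfl fun y _ => ?_
    rw [SetLike.val_smul, map_smul, map_smul]
    congr 1
    change extend k G X F (permBasis k X y - permBasis k X x₀) = _
    rw [map_sub, extend_basis, extend_basis, ← Finset.sum_sub_distrib,
      ← (permBasis k X).sum_repr (F (diff k G y x₀))]
    refine Finset.sum_congr rfl fun x _ => ?_
    rw [← sub_smul, ← map_sub, ← map_sub]
    have : diff k G y x - diff k G x₀ x = diff k G y x₀ := Subtype.ext (by
      simp [diff])
    rw [this]
    simp

variable [Finite G] [Fact p.Prime] [CharP k p]

lemma isSylowVertexTrivial_end_perm [Finite X] (hX : NoSylowFixedPoint p G X) :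
    IsSylowVertexTrivial p (linHom (ofMulAction k G X) (ofMulAction k G X)) := by
  have := perm_finite (k := k) (X := X)
  have hP := isPPermutation_perm (k := k) (G := G) (X := X)
  rw [isSylowVertexTrivial_iff]
  refine ⟨(hP.dual.tprod hP).summand (isSummand_of_nonempty_symm equiv_dualTensor), ?_⟩
  have h1 := (inIdeal_perm (k := k) hX).homMap_left (ρ := ofMulAction k G X)
  refine InIdeal.inTriv ?_
  convert h1 using 1
  rfl


lemma capped_syzygy [Finite X] [Nonempty X] (hX : NoSylowFixedPoint p G X) :
    IsDade p (Δ k G X) ∧ IsCapped p (Δ k G X) := by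
  have := Fintype.ofFinite X
  have := perm_finite (k := k) (X := X)
  obtain ⟨x₀⟩ : Nonempty X := inferInstance
  have hε : ∀ v : (syzygy k G X).toSubmodule, augmentation k X (v : MonoidAlgebra k X) = 0 :=
    fun v => v.2
  let ι := (syzygy k G X).toSubmodule.subtype
  let β : k × (MonoidAlgebra k X →ₗ[k] MonoidAlgebra k X) →ₗ[k]
      ((syzygy k G X).toSubmodule →ₗ[k] MonoidAlgebra k X) :=
    { toFun := fun a => (a.2 - diag k X (a.1 • augmentation k X + augmentation k X ∘ₗ a.2)) ∘ₗ ι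
      map_add' := fun a b => by
        ext v
        simp [add_smul, LinearMap.comp_add]
        abel
      map_smul' := fun c a => by
        ext v
        simp [mul_smul, LinearMap.comp_smul, smul_sub] }
  have hβ : ∀ a v, β a v ∈ (syzygy k G X).toSubmodule := fun a v => by
    change augmentation k X ((a.2 - diag k X _) (v : MonoidAlgebra k X)) = 0
    rw [LinearMap.sub_apply, map_sub, augmentation_diag]
    simp [hε]
  let β' : k × (MonoidAlgebra k X →ₗ[k] MonoidAlgebra k X) →ₗ[k]
      ((syzygy k G X).toSubmodule →ₗ[k] (syzygy k G X).toSubmodule) :=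
    { toFun := fun a => LinearMap.codRestrict _ (β a) (hβ a)
      map_add' := fun a b => by
        ext v
        simp
      map_smul' := fun c a => by
        ext v
        simp }
  have hβ' : ∀ a v, (β' a v : MonoidAlgebra k X) = a.2 v -
      diag k X (a.1 • augmentation k X + augmentation k X ∘ₗ a.2) v := fun a v => rfl
  let α : ((syzygy k G X).toSubmodule →ₗ[k] (syzygy k G X).toSubmodule) →ₗ[k]
      k × (MonoidAlgebra k X →ₗ[k] MonoidAlgebra k X) :=
    { toFun := fun F => (- augmentation k X (extend k G X (ι ∘ₗ F) (permBasis k X x₀)),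
        extend k G X (ι ∘ₗ F))
      map_add' := fun a b => by
        refine Prod.ext ?_ ?_
        · simp [LinearMap.comp_add]; abel
        · simp [LinearMap.comp_add]
      map_smul' := fun c a => by
        refine Prod.ext ?_ ?_
        · simp [LinearMap.comp_smul]
        · simp [LinearMap.comp_smul] }
  have hconst : ∀ F : (syzygy k G X).toSubmodule →ₗ[k] (syzygy k G X).toSubmodule,
      augmentation k X ∘ₗ extend k G X (ι ∘ₗ F) =
        augmentation k X (extend k G X (ι ∘ₗ F) (permBasis k X x₀)) • augmentation k X := fun F => by
    refine (permBasis k X).ext fun y => ?_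
    rw [LinearMap.comp_apply, LinearMap.smul_apply, augmentation_basis, smul_eq_mul, mul_one,
      ← sub_eq_zero, ← map_sub, ← map_sub]
    have := extend_diff (ι ∘ₗ F) (diff k G y x₀)
    change extend k G X (ι ∘ₗ F) (permBasis k X y - permBasis k X x₀) = _ at this
    rw [this]
    exact hε _
  refine ⟨⟨inferInstance, ?_⟩, ?_⟩
  · have hs := (isSylowVertexTrivial_trivial (p := p) (k := k) (G := G) (V := k)).prod
      (isSylowVertexTrivial_end_perm (k := k) hX)
    refine hs.summand (IsSummand.of_inv α β' ?_ ?_ ?_)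
    · intro g F
      have h1 : ι ∘ₗ linHom (Δ k G X) (Δ k G X) g F =
          linHom (Δ k G X) (ofMulAction k G X) g (ι ∘ₗ F) := rfl
      refine Prod.ext ?_ ?_
      · change - augmentation k X (extend k G X (ι ∘ₗ _) _) = - augmentation k X _
        rw [h1, extend_smul, linHom_apply, LinearMap.comp_apply, LinearMap.comp_apply,
          augmentation_smul, perm_basis_smul]
        have := DFunLike.congr_fun (hconst F) (permBasis k X (g⁻¹ • x₀))
        simp only [LinearMap.comp_apply, LinearMap.smul_apply, augmentation_basis, smul_eq_mul,
          mul_one] at this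
        rw [this]
      · change extend k G X (ι ∘ₗ _) = _
        rw [h1, extend_smul]
        rfl
    · rintro g ⟨a, E⟩
      refine LinearMap.ext fun v => Subtype.ext ?_
      have h1 : ((linHom (Δ k G X) (Δ k G X) g (β' (a, E)) v :
          (syzygy k G X).toSubmodule) : MonoidAlgebra k X) = ofMulAction k G X g
            (β' (a, E) (Δ k G X g⁻¹ v)) := rfl
      have h2 : ((Δ k G X g⁻¹ v : (syzygy k G X).toSubmodule) : MonoidAlgebra k X) =
        ofMulAction k G X g⁻¹ v := rfl
      have h3 : a • augmentation k X + augmentation k X ∘ₗ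
          linHom (ofMulAction k G X) (ofMulAction k G X) g E =
          (a • augmentation k X + augmentation k X ∘ₗ E) ∘ₗ ofMulAction k G X g⁻¹ :=
        LinearMap.ext fun w => by simp only [LinearMap.add_apply, LinearMap.smul_apply,
          LinearMap.comp_apply, linHom_apply, augmentation_smul]
      rw [h1, hβ', hβ', h2]
      change linHom (ofMulAction k G X) (ofMulAction k G X) g E v - diag k X
        (a • augmentation k X + augmentation k X ∘ₗ
          linHom (ofMulAction k G X) (ofMulAction k G X) g E) v = _
      rw [h3, diag_smul, map_sub]
      rfl
    · intro F
      refine LinearMap.ext fun v => Subtype.ext ?_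
      rw [hβ']
      have h1 : (α F).1 • augmentation k X + augmentation k X ∘ₗ (α F).2 = 0 := by
        change - augmentation k X _ • augmentation k X +
          augmentation k X ∘ₗ extend k G X (ι ∘ₗ F) = 0
        rw [hconst, ← add_smul, neg_add_cancel, zero_smul]
      rw [h1, map_zero]
      change extend k G X (ι ∘ₗ F) v - 0 = _
      rw [sub_zero, extend_diff]
      rfl
  · rw [isCapped_iff, noSylowVertexComponent_iff]
    intro hI
    have h1 := hI.finrank_eq_zero
    have h2 := (inIdeal_perm (k := k) hX).finrank_eq_zero
    have h3 := (augmentation k X).finrank_range_add_finrank_ker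
    have h4 : LinearMap.range (augmentation k X) = ⊤ :=
      LinearMap.range_eq_top.2 fun c => ⟨c • permBasis k X x₀, by simp [augmentation_basis]⟩
    rw [h4, finrank_top, Module.finrank_self] at h3
    rw [← h3, Nat.cast_add, Nat.cast_one] at h2
    have h5 : (Module.finrank k (LinearMap.ker (augmentation k X)) : k) = 0 := h1
    rw [h5, add_zero] at h2
    exact one_ne_zero h2

end Relative

section DadeGroup

/-! ### The Dade group -/

/-- The capped Dade modules. -/
def CappedDade (p : ℕ) (k G : Type u) [Field k] [Group G] : Type (u + 1) :=
  {A : Rep.{u} k G // IsDade p A.ρ ∧ IsCapped p A.ρ}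

variable {p : ℕ} {k G : Type u} [Field k] [Group G] [Finite G] [Fact p.Prime] [CharP k p]

lemma CappedDade.compatible_iff (A B : CappedDade p k G) :
    Compatible p A.1.ρ B.1.ρ ↔ IsSylowVertexTrivial p (linHom A.1.ρ B.1.ρ) :=
  DadeGroup.compatible_iff A.2.1 B.2.1

lemma compatible_dual {V W : Type u} [AddCommGroup V] [Module k V] [AddCommGroup W] [Module k W]
    {ρ : Representation k G V} {σ : Representation k G W}
    (h : IsDade p ρ ∧ IsCapped p ρ) (h' : IsDade p σ ∧ IsCapped p σ) (hc : Compatible p ρ σ) :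
    Compatible p ρ.dual σ.dual := by
  have := h.1.1
  have := h'.1.1
  rw [DadeGroup.compatible_iff h.1 h'.1] at hc
  rw [DadeGroup.compatible_iff (capped_dual h).1 (capped_dual h').1, dual_eq, dual_eq]
  exact hc.symm.summand (isSummand_of_nonempty_symm equiv_transpose)

lemma compatible_dual_tprod {V : Type u} [AddCommGroup V] [Module k V]
    {ρ : Representation k G V} (h : IsDade p ρ ∧ IsCapped p ρ) :
    Compatible (V := TensorProduct k (Module.Dual k V) V) p (ρ.dual.tprod ρ) (trivial k G k) := by
  have := h.1.1
  rw [DadeGroup.compatible_iff (capped_tprod (capped_dual h) h).1 capped_trivial.1, dual_eq]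
  refine h.1.2.dual.summand ?_
  have h0 := equiv_dualTensor (ρ := ρ)
  have h1 : IsSummand (V := TensorProduct k (V →ₗ[k] k) V) (W := V →ₗ[k] V)
      ((linHom ρ (trivial k G k)).tprod ρ) (linHom ρ ρ) := isSummand_of_nonempty h0
  have h2 := h1.linHom (IsSummand.refl (trivial k G k))
  exact h2

/-- Compatibility is an equivalence relation on capped Dade modules. -/
instance cappedDadeSetoid (p : ℕ) (k G : Type u) [Field k] [Group G] [Finite G] [Fact p.Prime]
    [CharP k p] : Setoid (CappedDade p k G) where
  r A B := Compatible p A.1.ρ B.1.ρ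
  iseqv :=
    { refl := fun A => (A.compatible_iff A).2 A.2.1.2
      symm := fun {A B} h => by
        have := A.2.1.1
        have := B.2.1.1
        rw [CappedDade.compatible_iff] at h ⊢
        exact h.symm
      trans := fun {A B C} h h' => by
        have := A.2.1.1
        have := B.2.1.1
        have := C.2.1.1
        rw [CappedDade.compatible_iff] at h h' ⊢
        exact h.trans ((isCapped_iff_unit B.2.1).1 B.2.2) h' }

/-- The Dade group `D(G)`: capped Dade modules up to compatibility. -/
def D (p : ℕ) (k G : Type u) [Field k] [Group G] [Finite G] [Fact p.Prime] [CharP k p] :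
    Type (u + 1) :=
  Quotient (cappedDadeSetoid p k G)

/-- The class `[M]` in `D(G)` of a capped Dade module `M`. -/
def D.mk {V : Type u} [AddCommGroup V] [Module k V] (ρ : Representation k G V)
    (h : IsDade p ρ ∧ IsCapped p ρ) : D p k G :=
  Quotient.mk _ ⟨Rep.of ρ, h⟩

lemma D.mk_eq_of_equiv {V W : Type u} [AddCommGroup V] [Module k V] [AddCommGroup W] [Module k W]
    {ρ : Representation k G V} {σ : Representation k G W}
    {h : IsDade p ρ ∧ IsCapped p ρ} {h' : IsDade p σ ∧ IsCapped p σ}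
    (e : Nonempty (ρ.Equiv σ)) : D.mk ρ h = D.mk σ h' :=
  Quotient.sound (compatible_of_equiv h.1 h'.1 e)

/-- `[M] + [N] = [M ⊗ N]`. -/
noncomputable instance : Add (D p k G) where
  add := Quotient.map₂ (fun A B => ⟨Rep.of (A.1.ρ.tprod B.1.ρ), capped_tprod A.2 B.2⟩)
    fun A A' h B B' h' => by
      have := A.2.1.1
      have := B.2.1.1
      have := A'.2.1.1
      have := B'.2.1.1
      have h1 := (A.compatible_iff A').1 h
      have h2 := (B.compatible_iff B').1 h'
      exact (CappedDade.compatible_iff _ _).2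
        ((h1.tprod h2).summand (isSummand_of_nonempty_symm equiv_homTensorHom))

/-- The neutral element is the class of the trivial module. -/
instance : Zero (D p k G) where
  zero := D.mk (trivial k G k) capped_trivial

/-- `-[M] = [M*]`. -/
noncomputable instance : Neg (D p k G) where
  neg := Quotient.map (fun A => ⟨Rep.of A.1.ρ.dual, capped_dual A.2⟩) fun A A' h =>
    compatible_dual A.2 A'.2 h

noncomputable instance : AddCommGroup (D p k G) where
  add_assoc := by
    rintro ⟨A⟩ ⟨B⟩ ⟨C⟩
    exact D.mk_eq_of_equiv equiv_tensorAssoc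
  zero_add := by
    rintro ⟨A⟩
    refine D.mk_eq_of_equiv (h' := A.2) ?_
    exact ⟨equiv_tensorComm.some.trans equiv_tensorUnit.some⟩
  add_zero := by
    rintro ⟨A⟩
    exact D.mk_eq_of_equiv (h' := A.2) equiv_tensorUnit
  add_comm := by
    rintro ⟨A⟩ ⟨B⟩
    exact D.mk_eq_of_equiv equiv_tensorComm
  neg_add_cancel := by
    rintro ⟨A⟩
    refine Quotient.sound ?_
    exact compatible_dual_tprod A.2
  nsmul := nsmulRec
  zsmul := zsmulRec

/-! ### The subgroup of relative syzygies -/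

/-- The class `Ω_X = [Δ(X)]`, for a finite non-empty `G`-set `X` with `X^S = ∅`. -/
noncomputable def Ω (p : ℕ) (k G X : Type u) [Field k] [Group G] [Finite G] [Fact p.Prime]
    [CharP k p] [MulAction G X] [Finite X] [Nonempty X] (hX : NoSylowFixedPoint p G X) :
    D p k G :=
  D.mk (Δ k G X) (capped_syzygy hX)

/-- The subgroup `D^Ω(G)` of `D(G)` generated by all `Ω_X`, `X` running over the finite non-empty
`G`-sets with `X^S = ∅`. -/
noncomputable def DΩ (p : ℕ) (k G : Type u) [Field k] [Group G] [Finite G] [Fact p.Prime] [CharP k p] :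
    AddSubgroup (D p k G) :=
  AddSubgroup.closure {d | ∃ (X : Type u) (_ : MulAction G X) (_ : Finite X) (_ : Nonempty X)
    (hX : NoSylowFixedPoint p G X), d = Ω p k G X hX}

/-- The set of the non-Sylow `p`-subgroups of `G`. -/
def nonSylow (p : ℕ) (G : Type u) [Group G] : Set (Subgroup G) :=
  {P | IsPGroup p P ∧ ∀ S : Sylow p G, (S : Subgroup G) ≠ P}

lemma noSylowFixedPoint_of_nonSylow (P : nonSylow p G) : NoSylowFixedPoint p G (G ⧸ P.1) :=
  noSylowFixedPoint_quotient fun S h => P.2.2 S (S.is_maximal' P.2.1 h).symm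

end DadeGroup

end DadeGroup

namespace DadeGroup

open Representation

/-! ### Compatibility of modules that differ by a relatively projective one -/

section Compatibility

variable {p : ℕ} {k G V W U : Type u} [Field k] [Group G]
  [AddCommGroup V] [Module k V] [AddCommGroup W] [Module k W] [AddCommGroup U] [Module k U]
  {ρ : Representation k G V} {σ : Representation k G W} {τ : Representation k G U}

/-! Everything rests on two facts about the classes `Ω_X`.

The first is that `Ω_X` depends only on the set of `p`-subgroups of `G` that fix a point of `X`
(`Ω_eq_of_fixingSubgroups_eq`). Suppose every `p`-subgroup fixing a point of `Y` also fixes a point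
of `X`. For `y ∈ Y` with stabilizer `H`, a Sylow `p`-subgroup of `H` then fixes some `x ∈ X`, so the
`H`-orbit of `x` has length prime to `p`, and its average is an `H`-invariant element of `kX` of
augmentation `1`. These averages assemble to a `kG`-map `kY → kX` over `k`. If such maps exist in
both directions, Schanuel's argument for the two augmentation sequences makes `Δ(Y)` a direct
summand of `Δ(X) ⊕ kY`. The extra term `kY` is projective relative to the non-Sylow `p`-subgroups
and does not affect the class in `D(G)`.

The second is the relation `Ω_X + Ω_Y = Ω_{X × Y} + Ω_{X ⊔ Y}` (`Ω_add_Ω`). It comes from the exact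
sequence `0 → Δ(X) ⊗ Δ(Y) → k(X × Y) → Δ(X ⊔ Y) → 0`, with second map `(x, y) ↦ x - y`, which splits
over the stabilizer of every point of `X × Y`. With `Z = X × Y` and `M = Δ(X ⊔ Y)`, a relative
Schanuel lemma compares it with `0 → Δ(Z) ⊗ M → kZ ⊗ M → M → 0`. Hence `Δ(X) ⊗ Δ(Y)` is a direct
summand of `(Δ(Z) ⊗ M) ⊕ kZ`, and again `kZ` does not matter.

Generation follows by induction on the number of `p`-subgroups that fix a point of `X`
(`Ω_mem_closure`). Let `P` have maximal order among them, and let `Y` be the union of the orbits of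
`X` on which `P` has no fixed point. If `P` fixes a point in the orbit of `x`, then by maximality a
conjugate of `P` is a Sylow subgroup of the stabilizer of `x`, so this orbit contributes nothing
beyond `G/P`. Thus `X` and `G/P ⊔ Y` have the same fixing `p`-subgroups, and the two facts give `Ω_X
= Ω_{G/P} + Ω_Y - Ω_{G/P × Y}`. Both `Y` and `G/P × Y` have fewer fixing `p`-subgroups, since `P` is
no longer among them. -/

lemma isSummand_linHom_prod :
    IsSummand (linHom ρ (σ.prod τ)) ((linHom ρ σ).prod (linHom ρ τ)) :=
  IsSummand.of_inv
    { toFun := fun f => (LinearMap.fst k W U ∘ₗ f, LinearMap.snd k W U ∘ₗ f)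
      map_add' := fun f f' => by simp [LinearMap.comp_add]
      map_smul' := fun c f => by simp [LinearMap.comp_smul] }
    { toFun := fun f => LinearMap.prod f.1 f.2
      map_add' := fun f f' => by ext <;> simp
      map_smul' := fun c f => by ext <;> simp }
    (fun g f => Prod.ext (by ext v; simp) (by ext v; simp))
    (fun g f => by ext v <;> simp) (fun f => by ext v <;> simp)

/-- Inserting unit factors turns `Hom(M, N)` into `Hom(M ⊗ k, k ⊗ N)`, which is `Hom(M, k) ⊗ Hom(k,
N)` in finite dimension, so closure under duals and tensor products suffices. -/
lemma IsPPermutation.linHom (h : IsPPermutation ρ) (h' : IsPPermutation σ) :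
    IsPPermutation (linHom ρ σ) := by
  have := h.finite
  have := h'.finite
  refine (h.dual.tprod (h'.summand (isSummand_of_nonempty equiv_homUnit))).summand
    (IsSummand.trans ?_ (isSummand_of_nonempty_symm equiv_homTensorHom))
  refine (isSummand_of_nonempty_symm equiv_tensorUnit).linHom ?_
  exact (isSummand_of_nonempty_symm equiv_tensorUnit).trans
    (isSummand_of_nonempty equiv_tensorComm)

/-- The trace form identifies `Hom(N, M)` with the dual of `Hom(M, N)`. This reversal is needed
because the splitting arguments control maps out of a permutation module, while the compatibility
criterion asks about maps into one. -/
lemma IsPPermutation.linHom_symm [Module.Finite k V] [Module.Finite k W]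
    (h : IsPPermutation (Representation.linHom ρ σ)) :
    IsPPermutation (Representation.linHom σ ρ) :=
  h.dual.summand (isSummand_of_nonempty equiv_trace)

/-- Adding a module that is projective relative to the non-Sylow `p`-subgroups does not change the
class of a capped Dade module. -/
lemma compatible_of_isSummand_prod [Finite G] [Fact p.Prime] [CharP k p] (h : IsDade p ρ) (h' : IsDade p σ)
    (hτ : InIdeal p τ τ LinearMap.id) (hp : IsPPermutation (linHom ρ τ))
    (hs : IsSummand σ (ρ.prod τ)) : Compatible p ρ σ := by
  rw [compatible_iff h h']
  -- Postcomposition carries the trace expression for the identity of `τ` to one for the identity of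
  -- `Hom(ρ, τ)`. This Hom-module is therefore relatively projective, and being `p`-permutation it
  -- is Sylow-vertex trivial.
  have h1 : IsSylowVertexTrivial p (linHom ρ τ) := by
    refine isSylowVertexTrivial_iff.2 ⟨hp, InIdeal.inTriv ?_⟩
    convert hτ.homMap_left (ρ := ρ) using 1
    rfl
  exact ((h.2.prod h1).summand isSummand_linHom_prod).summand ((IsSummand.refl _).linHom hs)

end Compatibility

/-! ### Splitting over point stabilizers and a relative Schanuel lemma -/

section Splitting

variable {k G N P M N' P' Z : Type u} [Field k] [Group G] [MulAction G Z]
  [AddCommGroup N] [Module k N] [AddCommGroup P] [Module k P] [AddCommGroup M] [Module k M]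
  [AddCommGroup N'] [Module k N'] [AddCommGroup P'] [Module k P']
  {ν : Representation k G N} {π : Representation k G P} {μ : Representation k G M}
  {ν' : Representation k G N'} {π' : Representation k G P'}

/-- A map that splits after restriction to the stabilizers of `Z` splits after applying
`Hom(kZ, -)`. -/
lemma isSummand_linHom_perm (i : ν.IntertwiningMap π) (q : Z → P →ₗ[k] N)
    (hq : ∀ (g : G) z v, q (g • z) (π g v) = ν g (q z v)) (h : ∀ z v, q z (i v) = v) :
    IsSummand (linHom (ofMulAction k G Z) ν) (linHom (ofMulAction k G Z) π) := by
  refine IsSummand.of_inv (homMap LinearMap.id i.toLinearMap)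
    -- No single `q z` need commute with `G`. The retraction uses `q z` only on the value at the
    -- basis vector `z`, and the equivariance `hq` of the whole family makes it a `kG`-map.
    { toFun := fun f => (permBasis k Z).constr k fun z => q z (f (permBasis k Z z))
      map_add' := fun f f' => (permBasis k Z).ext fun z => by simp
      map_smul' := fun c f => (permBasis k Z).ext fun z => by simp } ?_ ?_ ?_
  · intro g f
    ext v
    simp [i.isIntertwining]
  · intro g f
    refine (permBasis k Z).ext fun z => ?_
    simp only [LinearMap.coe_mk, AddHom.coe_mk, Module.Basis.constr_basis, linHom_apply,
      LinearMap.comp_apply, perm_basis_smul]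
    rw [← hq, smul_inv_smul]
  · intro f
    refine (permBasis k Z).ext fun z => ?_
    simp [h]

/-- A map that splits after restriction to the stabilizers of `Z` splits after tensoring
with `kZ`. -/
lemma isSummand_perm_tprod (i : ν.IntertwiningMap π) (q : Z → P →ₗ[k] N)
    (hq : ∀ (g : G) z v, q (g • z) (π g v) = ν g (q z v)) (h : ∀ z v, q z (i v) = v) :
    IsSummand ((ofMulAction k G Z).tprod ν) ((ofMulAction k G Z).tprod π) := by
  -- As for Hom-modules, the retraction applies `q z` on the part `z ⊗ P`, and `G` permutes these
  -- parts together with the maps `q z`.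
  let r := TensorProduct.lift
    ((permBasis k Z).constr k fun z => TensorProduct.mk k _ _ (permBasis k Z z) ∘ₗ q z)
  have hr : ∀ z v, r (permBasis k Z z ⊗ₜ[k] v) = permBasis k Z z ⊗ₜ[k] q z v := fun z v => by
    simp [r]
  refine IsSummand.of_inv (TensorProduct.map LinearMap.id i.toLinearMap) r ?_ ?_ ?_
  · intro g x
    induction x using TensorProduct.induction_on with
    | zero => simp
    | tmul f v => simp [i.isIntertwining]
    | add x y hx hy => simp only [map_add, hx, hy]
  · intro g x
    suffices H : r ∘ₗ (ofMulAction k G Z).tprod π g = (ofMulAction k G Z).tprod ν g ∘ₗ r from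
      DFunLike.congr_fun H x
    refine TensorProduct.ext ((permBasis k Z).ext fun z => LinearMap.ext fun v => ?_)
    change r (ofMulAction k G Z g (permBasis k Z z) ⊗ₜ[k] π g v) =
      TensorProduct.map (ofMulAction k G Z g) (ν g) (r (permBasis k Z z ⊗ₜ[k] v))
    rw [perm_basis_smul, hr, hr, TensorProduct.map_tmul, perm_basis_smul, hq]
  · intro x
    suffices H : r ∘ₗ TensorProduct.map LinearMap.id i.toLinearMap = LinearMap.id from
      DFunLike.congr_fun H x
    refine TensorProduct.ext ((permBasis k Z).ext fun z => LinearMap.ext fun v => ?_)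
    simp [hr, h]

/-- A relative version of Schanuel's lemma. -/
lemma isSummand_prod_of_lifts (i : ν.IntertwiningMap π) (e : π.IntertwiningMap μ)
    (i' : ν'.IntertwiningMap π') (e' : π'.IntertwiningMap μ)
    (φ : π.IntertwiningMap π') (ψ : π'.IntertwiningMap π)
    (hφ : ∀ v, e' (φ v) = e v) (hψ : ∀ v, e (ψ v) = e' v)
    (q : P →ₗ[k] N) (hq : ∀ n, q (i n) = n) (hei : ∀ n, e (i n) = 0)
    (hiq : ∀ v, e v = 0 → i (q v) = v)
    (q' : P' →ₗ[k] N') (hq' : ∀ n, q' (i' n) = n) (hei' : ∀ n, e' (i' n) = 0)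
    (hiq' : ∀ v, e' v = 0 → i' (q' v) = v) : IsSummand ν (ν'.prod π) := by
  -- The retraction `q` is only `k`-linear, but on `ker e` it is inverse to the `kG`-map `i` and so
  -- commutes with `G` there. The same holds for `q'` on `ker e'`. Both are applied to elements of
  -- these kernels only.
  have key : ∀ (g : G) v, e v = 0 → q (π g v) = ν g (q v) := fun g v hv => by
    conv_lhs => rw [← hiq v hv]
    rw [← i.isIntertwining, hq]
  have key' : ∀ (g : G) v, e' v = 0 → q' (π' g v) = ν' g (q' v) := fun g v hv => by
    conv_lhs => rw [← hiq' v hv]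
    rw [← i'.isIntertwining, hq']
  -- Since `φ` and `ψ` are maps over `M`, the element `b - ψ (i' a + φ b)` lies in `ker e`. For `(a,
  -- b)` in the image of `n`, the bracket vanishes because `i'` undoes `q'` on `ker e'`, which
  -- leaves `q (i n) = n`.
  refine IsSummand.of_inv
    (LinearMap.prod (-(q' ∘ₗ φ.toLinearMap ∘ₗ i.toLinearMap)) i.toLinearMap)
    (q ∘ₗ (LinearMap.snd k N' P - ψ.toLinearMap ∘ₗ
      LinearMap.coprod i'.toLinearMap φ.toLinearMap)) ?_ ?_ ?_
  · intro g v
    refine Prod.ext ?_ ?_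
    · change -q' (φ (i (ν g v))) = ν' g (-q' (φ (i v)))
      rw [i.isIntertwining, φ.isIntertwining, key' _ _ (by rw [hφ, hei]), map_neg]
    · exact i.isIntertwining ..
  · rintro g ⟨a, b⟩
    change q (π g b - ψ (i' (ν' g a) + φ (π g b))) = ν g (q (b - ψ (i' a + φ b)))
    rw [← key _ _ (by rw [map_sub, hψ, map_add, hei', hφ, zero_add, sub_self]),
      map_sub (π g), ← ψ.isIntertwining, map_add (π' g), ← φ.isIntertwining, ← i'.isIntertwining]
  · intro v
    change q (i v - ψ (i' (-q' (φ (i v))) + φ (i v))) = v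
    rw [map_neg, hiq' _ (by rw [hφ, hei]), neg_add_cancel, map_zero, sub_zero, hq]

end Splitting

/-! ### Comparing relative syzygies through augmentation-preserving maps -/

section Augmented

variable {k G X Y Z : Type u} [Field k] [Group G] [MulAction G X] [MulAction G Y] [MulAction G Z]

/-- The projection `kX → Δ(X)` along an element of augmentation `1`. -/
noncomputable def syzygyProj (k G X : Type u) [Field k] [Group G] [MulAction G X]
    (x : MonoidAlgebra k X) (hx : augmentation k X x = 1) :
    MonoidAlgebra k X →ₗ[k] (syzygy k G X).toSubmodule :=
  LinearMap.codRestrict _ (LinearMap.id - (augmentation k X).smulRight x) fun v => by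
    change augmentation k X (v - augmentation k X v • x) = 0
    rw [map_sub, map_smul, hx, smul_eq_mul, mul_one, sub_self]

lemma coe_syzygyProj (x : MonoidAlgebra k X) (hx : augmentation k X x = 1)
    (v : MonoidAlgebra k X) :
    (syzygyProj k G X x hx v : MonoidAlgebra k X) = v - augmentation k X v • x := rfl

lemma syzygyProj_coe (x : MonoidAlgebra k X) (hx : augmentation k X x = 1)
    (v : (syzygy k G X).toSubmodule) : syzygyProj k G X x hx v = v := by
  have hv : augmentation k X v = 0 := v.2
  refine Subtype.ext ?_
  rw [coe_syzygyProj, hv, zero_smul, sub_zero]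

/-- The projection commutes with `g` once the element of augmentation `1` is moved along. An
equivariant family of such elements indexed by `Z` thus yields a family of retractions of the kind
that `isSummand_linHom_perm` and `isSummand_perm_tprod` require. -/
lemma syzygyProj_smul (x : MonoidAlgebra k X) (hx : augmentation k X x = 1) (g : G)
    (hgx : augmentation k X (ofMulAction k G X g x) = 1) (v : MonoidAlgebra k X) :
    syzygyProj k G X (ofMulAction k G X g x) hgx (ofMulAction k G X g v) =
      Δ k G X g (syzygyProj k G X x hx v) := by
  refine Subtype.ext ?_
  change _ = ofMulAction k G X g (syzygyProj k G X x hx v : MonoidAlgebra k X)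
  rw [coe_syzygyProj, coe_syzygyProj, augmentation_smul, map_sub, map_smul]

/-- The inclusion `Δ(X) → kX`. -/
noncomputable def syzygyIncl (k G X : Type u) [Field k] [Group G] [MulAction G X] :
    (Δ k G X).IntertwiningMap (ofMulAction k G X) :=
  ⟨(syzygy k G X).toSubmodule.subtype, fun _ => rfl⟩

/-- The line spanned by `f z` is a complement of `Δ(X)` in `kX`, invariant under the stabilizer of
`z`, so the augmentation sequence of `X` splits over all stabilizers of points of `Z`. -/
lemma isSummand_linHom_syzygy (f : Z → MonoidAlgebra k X)
    (hf : ∀ (g : G) z, f (g • z) = ofMulAction k G X g (f z))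
    (hε : ∀ z, augmentation k X (f z) = 1) :
    IsSummand (V := MonoidAlgebra k Z →ₗ[k] (syzygy k G X).toSubmodule)
      (W := MonoidAlgebra k Z →ₗ[k] MonoidAlgebra k X) (linHom (ofMulAction k G Z) (Δ k G X))
      (linHom (ofMulAction k G Z) (ofMulAction k G X)) := by
  refine isSummand_linHom_perm (syzygyIncl k G X) (fun z => syzygyProj k G X (f z) (hε z)) ?_
    fun z => syzygyProj_coe _ _
  intro g z v
  simp only [hf]
  exact syzygyProj_smul ..

/-- The complements spanned by the `f z` serve for tensor products with `kZ` just as they do for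
homomorphisms from `kZ`. -/
lemma isSummand_perm_tprod_syzygy (f : Z → MonoidAlgebra k X)
    (hf : ∀ (g : G) z, f (g • z) = ofMulAction k G X g (f z))
    (hε : ∀ z, augmentation k X (f z) = 1) :
    IsSummand ((ofMulAction k G Z).tprod (Δ k G X))
      ((ofMulAction k G Z).tprod (ofMulAction k G X)) := by
  refine isSummand_perm_tprod (syzygyIncl k G X) (fun z => syzygyProj k G X (f z) (hε z)) ?_
    fun z => syzygyProj_coe _ _
  intro g z v
  simp only [hf]
  exact syzygyProj_smul ..

lemma augmentation_constr (f : Y → MonoidAlgebra k X) (hε : ∀ y, augmentation k X (f y) = 1)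
    (v : MonoidAlgebra k Y) :
    augmentation k X ((permBasis k Y).constr k f v) = augmentation k Y v := by
  suffices H : augmentation k X ∘ₗ (permBasis k Y).constr k f = augmentation k Y from
    DFunLike.congr_fun H v
  exact (permBasis k Y).ext fun y => by simp [hε, augmentation_basis]

lemma perm_constr_smul (f : Y → MonoidAlgebra k X)
    (hf : ∀ (g : G) y, f (g • y) = ofMulAction k G X g (f y)) (g : G)
    (v : MonoidAlgebra k Y) :
    (permBasis k Y).constr k f (ofMulAction k G Y g v) =
      ofMulAction k G X g ((permBasis k Y).constr k f v) := by
  suffices H : (permBasis k Y).constr k f ∘ₗ ofMulAction k G Y g =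
      ofMulAction k G X g ∘ₗ (permBasis k Y).constr k f from DFunLike.congr_fun H v
  exact (permBasis k Y).ext fun y => by
    simp only [LinearMap.comp_apply, perm_basis_smul, Module.Basis.constr_basis, hf]

/-- `Δ(Y)` divides `Δ(X) ⊕ kY` if there are augmentation-preserving maps between `kX` and `kY`. -/
lemma isSummand_syzygy (f : Y → MonoidAlgebra k X)
    (hf : ∀ (g : G) y, f (g • y) = ofMulAction k G X g (f y))
    (hε : ∀ y, augmentation k X (f y) = 1) (f' : X → MonoidAlgebra k Y)
    (hf' : ∀ (g : G) x, f' (g • x) = ofMulAction k G Y g (f' x))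
    (hε' : ∀ x, augmentation k Y (f' x) = 1) :
    IsSummand (Δ k G Y) ((Δ k G X).prod (ofMulAction k G Y)) := by
  let φ := (permBasis k Y).constr k f
  let ψ := (permBasis k X).constr k f'
  have hY : ∀ v : (syzygy k G Y).toSubmodule, augmentation k Y (v : MonoidAlgebra k Y) = 0 :=
    fun v => v.2
  have hX : ∀ v : (syzygy k G X).toSubmodule, augmentation k X (v : MonoidAlgebra k X) = 0 :=
    fun v => v.2
  have hφ : ∀ v, augmentation k X (φ v) = augmentation k Y v := augmentation_constr f hε
  have hψ : ∀ v, augmentation k Y (ψ v) = augmentation k X v := augmentation_constr f' hε'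
  have hφ' : ∀ (g : G) v, φ (ofMulAction k G Y g v) = ofMulAction k G X g (φ v) :=
    perm_constr_smul f hf
  have hψ' : ∀ (g : G) v, ψ (ofMulAction k G X g v) = ofMulAction k G Y g (ψ v) :=
    perm_constr_smul f' hf'
  -- This is Schanuel's construction for the two augmentation sequences over `k`, with lifts `φ` and
  -- `ψ`. As the kernels are actual submodules, restricting codomains takes the place of the linear
  -- retractions.
  let a : (syzygy k G Y).toSubmodule →ₗ[k] (syzygy k G X).toSubmodule :=
    LinearMap.codRestrict _ (-(φ ∘ₗ (syzygy k G Y).toSubmodule.subtype)) fun v => by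
      change augmentation k X (-φ v) = 0
      rw [map_neg, hφ, hY, neg_zero]
  let r : (syzygy k G X).toSubmodule × MonoidAlgebra k Y →ₗ[k] (syzygy k G Y).toSubmodule :=
    LinearMap.codRestrict _ (LinearMap.snd k _ _ - ψ ∘ₗ
      LinearMap.coprod (syzygy k G X).toSubmodule.subtype φ) fun v => by
      change augmentation k Y (v.2 - ψ (v.1 + φ v.2)) = 0
      rw [map_sub, hψ, map_add, hφ, hX, zero_add, sub_self]
  refine IsSummand.of_inv (LinearMap.prod a (syzygy k G Y).toSubmodule.subtype) r ?_ ?_ ?_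
  · intro g v
    refine Prod.ext (Subtype.ext ?_) rfl
    change -φ (ofMulAction k G Y g v) = ofMulAction k G X g (-φ v)
    rw [hφ', map_neg]
  · rintro g ⟨v, w⟩
    refine Subtype.ext ?_
    change ofMulAction k G Y g w - ψ (ofMulAction k G X g v + φ (ofMulAction k G Y g w)) =
      ofMulAction k G Y g (w - ψ (v + φ w))
    rw [hφ', ← map_add, hψ', map_sub]
  · intro v
    refine Subtype.ext ?_
    change (v : MonoidAlgebra k Y) - ψ (-φ v + φ v) = v
    rw [neg_add_cancel, map_zero, sub_zero]

variable {p : ℕ} [Finite G] [Fact p.Prime] [CharP k p]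

/-- `Δ(Y)` divides `Δ(X) ⊕ kY` and `kY` is relatively projective, so `compatible_of_isSummand_prod`
applies as soon as `Hom(Δ(X), kY)` is a `p`-permutation module. After dualizing, this concerns
`Hom(kY, Δ(X))`, which divides `Hom(kY, kX)` thanks to `f`. -/
lemma Ω_eq_of_maps [Finite X] [Nonempty X] [Finite Y] [Nonempty Y]
    (hX : NoSylowFixedPoint p G X) (hY : NoSylowFixedPoint p G Y) (f : Y → MonoidAlgebra k X)
    (hf : ∀ (g : G) y, f (g • y) = ofMulAction k G X g (f y))
    (hε : ∀ y, augmentation k X (f y) = 1) (f' : X → MonoidAlgebra k Y)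
    (hf' : ∀ (g : G) x, f' (g • x) = ofMulAction k G Y g (f' x))
    (hε' : ∀ x, augmentation k Y (f' x) = 1) : Ω p k G X hX = Ω p k G Y hY := by
  have := perm_finite (k := k) (X := X)
  have := perm_finite (k := k) (X := Y)
  refine Quotient.sound (compatible_of_isSummand_prod (capped_syzygy hX).1 (capped_syzygy hY).1
    (inIdeal_perm hY) (IsPPermutation.linHom_symm ?_) (isSummand_syzygy f hf hε f' hf' hε'))
  exact (isPPermutation_perm.linHom isPPermutation_perm).summand
    (isSummand_linHom_syzygy f hf hε)

end Augmented

/-! ### Dependence of `Ω_X` on the `p`-subgroups fixing a point -/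

section FixingSubgroups

/-- The `p`-subgroups of `G` that fix a point of `X`. -/
def fixingSubgroups (p : ℕ) (G X : Type u) [Group G] [MulAction G X] : Set (Subgroup G) :=
  {P | IsPGroup p P ∧ ∃ x : X, P ≤ MulAction.stabilizer G x}

variable {p : ℕ} {k G X Y : Type u} [Field k] [Group G] [MulAction G X] [MulAction G Y]
  [Finite G] [Fact p.Prime] [CharP k p]

/-- The vector is the average of the `H`-orbit of `x`. The length of this orbit is the index in `H`
of a subgroup containing the Sylow subgroup `P`, hence prime to `p` and invertible in `k`. -/
lemma exists_invariant_augmentation_eq_one [Finite X] {H : Subgroup G} {x : X}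
    (P : Sylow p H) (hx : ∀ g ∈ P, g • x = x) : ∃ v : MonoidAlgebra k X,
      (∀ h ∈ H, ofMulAction k G X h v = v) ∧ augmentation k X v = 1 := by
  classical
  have := Fintype.ofFinite (MulAction.orbit H x)
  have hc : ((Fintype.card (MulAction.orbit H x) : ℕ) : k) ≠ 0 := by
    rw [Ne, CharP.cast_eq_zero_iff k p, ← Nat.card_eq_fintype_card]
    intro h
    have h1 := MulAction.index_stabilizer H x
    rw [← Nat.card_coe_set_eq] at h1
    rw [← h1] at h
    have h2 : (P : Subgroup H) ≤ MulAction.stabilizer H x := fun g hg => hx g hg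
    exact P.not_dvd_index (h.trans (Subgroup.index_dvd_of_le h2))
  refine ⟨((Fintype.card (MulAction.orbit H x) : ℕ) : k)⁻¹ •
    ∑ y : MulAction.orbit H x, permBasis k X (y : X), fun h hh => ?_, ?_⟩
  · rw [map_smul, map_sum]
    congr 1
    simp only [perm_basis_smul]
    exact Fintype.sum_equiv (MulAction.toPerm (⟨h, hh⟩ : H)) _ _ fun y => rfl
  · rw [map_smul, map_sum]
    simp only [augmentation_basis]
    rw [Finset.sum_const, Finset.card_univ, nsmul_eq_mul, mul_one, smul_eq_mul,
      inv_mul_cancel₀ hc]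

/-- An equivariant map out of `Y` amounts to a choice, for one point in each orbit, of a vector
invariant under its stabilizer. Averaging supplies such vectors, because a Sylow `p`-subgroup of a
stabilizer fixes a point of `Y`, hence one of `X`. -/
lemma exists_augmented_map [Finite X] (h : fixingSubgroups p G Y ⊆ fixingSubgroups p G X) :
    ∃ f : Y → MonoidAlgebra k X, (∀ (g : G) y, f (g • y) = ofMulAction k G X g (f y)) ∧
      ∀ y, augmentation k X (f y) = 1 := by
  have key : ∀ y : Y, ∃ v : MonoidAlgebra k X,
      (∀ h ∈ MulAction.stabilizer G y, ofMulAction k G X h v = v) ∧ augmentation k X v = 1 := by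
    intro y
    obtain ⟨P⟩ : Nonempty (Sylow p (MulAction.stabilizer G y)) := inferInstance
    obtain ⟨-, x, hx⟩ := h (show (P : Subgroup (MulAction.stabilizer G y)).map
      (MulAction.stabilizer G y).subtype ∈ fixingSubgroups p G Y from
        ⟨P.isPGroup'.map _, y, Subgroup.map_subtype_le _⟩)
    exact exists_invariant_augmentation_eq_one P fun g hg =>
      hx (Subgroup.mem_map_of_mem (MulAction.stabilizer G y).subtype hg)
  choose v hv hε using key
  let r : Y → Y := fun y => (Quotient.mk (MulAction.orbitRel G Y) y).out
  have hr : ∀ y, ∃ g : G, g • r y = y := fun y =>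
    MulAction.orbitRel_apply.1
      ((MulAction.orbitRel G Y).symm (Quotient.mk_out (s := MulAction.orbitRel G Y) y))
  choose t ht using hr
  have hrg : ∀ (g : G) y, r (g • y) = r y := fun g y =>
    congrArg Quotient.out (Quotient.sound (MulAction.orbitRel_apply.2 ⟨g, rfl⟩))
  refine ⟨fun y => ofMulAction k G X (t y) (v (r y)), fun g y => ?_, fun y => ?_⟩
  · have h1 : (g * t y)⁻¹ * t (g • y) ∈ MulAction.stabilizer G (r y) := by
      rw [MulAction.mem_stabilizer_iff, mul_smul, inv_smul_eq_iff, mul_smul, ht]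
      nth_rewrite 1 [← hrg g y]
      exact ht _
    have h2 := hv _ _ h1
    change ofMulAction k G X (t (g • y)) (v (r (g • y))) = _
    rw [hrg]
    change _ = (ofMulAction k G X g * ofMulAction k G X (t y)) (v (r y))
    rw [← map_mul]
    nth_rewrite 2 [← h2]
    change _ = (ofMulAction k G X (g * t y) *
      ofMulAction k G X ((g * t y)⁻¹ * t (g • y))) (v (r y))
    rw [← map_mul, mul_inv_cancel_left]
  · rw [augmentation_smul, hε]

/-- `Ω_X` depends only on the `p`-subgroups with a fixed point on `X`. -/
lemma Ω_eq_of_fixingSubgroups_eq [Finite X] [Nonempty X] [Finite Y] [Nonempty Y]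
    (hX : NoSylowFixedPoint p G X) (hY : NoSylowFixedPoint p G Y)
    (h : fixingSubgroups p G X = fixingSubgroups p G Y) : Ω p k G X hX = Ω p k G Y hY := by
  obtain ⟨f, hf, hε⟩ := exists_augmented_map (k := k) h.ge
  obtain ⟨f', hf', hε'⟩ := exists_augmented_map (k := k) h.le
  exact Ω_eq_of_maps hX hY f hf hε f' hf' hε'

end FixingSubgroups

/-! ### The sequence `0 → Δ(X) ⊗ Δ(Y) → k(X × Y) → Δ(X ⊔ Y) → 0` -/

section Sum

variable {k G X Y : Type u} [Field k] [Group G] [MulAction G X] [MulAction G Y]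

/-- The isomorphism `kX ⊗ kY ≅ k(X × Y)`. -/
noncomputable def permProdEquiv (k X Y : Type u) [Field k] :
    TensorProduct k (MonoidAlgebra k X) (MonoidAlgebra k Y) ≃ₗ[k] MonoidAlgebra k (X × Y) :=
  ((permBasis k X).tensorProduct (permBasis k Y)).equiv (permBasis k (X × Y)) (Equiv.refl _)

lemma permProdEquiv_tmul (x : X) (y : Y) :
    permProdEquiv k X Y (permBasis k X x ⊗ₜ[k] permBasis k Y y) = permBasis k (X × Y) (x, y) := by
  rw [permProdEquiv, ← Module.Basis.tensorProduct_apply, Module.Basis.equiv_apply]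
  rfl

lemma permProdEquiv_smul (g : G)
    (v : TensorProduct k (MonoidAlgebra k X) (MonoidAlgebra k Y)) :
    permProdEquiv k X Y ((ofMulAction k G X).tprod (ofMulAction k G Y) g v) =
      ofMulAction k G (X × Y) g (permProdEquiv k X Y v) := by
  suffices H : (permProdEquiv k X Y).toLinearMap ∘ₗ
      (ofMulAction k G X).tprod (ofMulAction k G Y) g =
      ofMulAction k G (X × Y) g ∘ₗ (permProdEquiv k X Y).toLinearMap from DFunLike.congr_fun H v
  refine ((permBasis k X).tensorProduct (permBasis k Y)).ext fun z => ?_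
  simp only [LinearMap.comp_apply, LinearEquiv.coe_coe, Module.Basis.tensorProduct_apply',
    Representation.tprod_apply, TensorProduct.map_tmul, perm_basis_smul, permProdEquiv_tmul]
  rfl

/-- The inclusion of `Δ(X) ⊗ Δ(Y)` into `k(X × Y)`. -/
noncomputable def tensorIncl (k G X Y : Type u) [Field k] [Group G] [MulAction G X]
    [MulAction G Y] :
    ((Δ k G X).tprod (Δ k G Y)).IntertwiningMap (ofMulAction k G (X × Y)) :=
  ⟨(permProdEquiv k X Y).toLinearMap ∘ₗ
    TensorProduct.map (syzygyIncl k G X).toLinearMap (syzygyIncl k G Y).toLinearMap, fun g =>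
    TensorProduct.ext' fun v w =>
      permProdEquiv_smul g ((v : MonoidAlgebra k X) ⊗ₜ[k] (w : MonoidAlgebra k Y))⟩

lemma tensorIncl_tmul (v : (syzygy k G X).toSubmodule) (w : (syzygy k G Y).toSubmodule) :
    tensorIncl k G X Y (v ⊗ₜ[k] w) =
      permProdEquiv k X Y ((v : MonoidAlgebra k X) ⊗ₜ[k] (w : MonoidAlgebra k Y)) := rfl

/-- The retraction of `tensorIncl` given by a point of `X × Y`. -/
noncomputable def tensorProj (k G : Type u) {X Y : Type u} [Field k] [Group G] [MulAction G X]
    [MulAction G Y] (z : X × Y) : MonoidAlgebra k (X × Y) →ₗ[k]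
      TensorProduct k (syzygy k G X).toSubmodule (syzygy k G Y).toSubmodule :=
  TensorProduct.map (syzygyProj k G X _ (augmentation_basis X z.1))
    (syzygyProj k G Y _ (augmentation_basis Y z.2)) ∘ₗ (permProdEquiv k X Y).symm.toLinearMap

lemma tensorProj_permProdEquiv (z : X × Y) (v : MonoidAlgebra k X) (w : MonoidAlgebra k Y) :
    tensorProj k G z (permProdEquiv k X Y (v ⊗ₜ[k] w)) =
      syzygyProj k G X _ (augmentation_basis X z.1) v ⊗ₜ[k]
        syzygyProj k G Y _ (augmentation_basis Y z.2) w := by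
  rw [tensorProj, LinearMap.comp_apply, LinearEquiv.coe_coe, LinearEquiv.symm_apply_apply,
    TensorProduct.map_tmul]

lemma tensorProj_tensorIncl (z : X × Y)
    (v : TensorProduct k (syzygy k G X).toSubmodule (syzygy k G Y).toSubmodule) :
    tensorProj k G z (tensorIncl k G X Y v) = v := by
  suffices H : tensorProj k G z ∘ₗ (tensorIncl k G X Y).toLinearMap = LinearMap.id from
    DFunLike.congr_fun H v
  refine TensorProduct.ext' fun v w => ?_
  change tensorProj k G z (tensorIncl k G X Y (v ⊗ₜ[k] w)) = v ⊗ₜ[k] w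
  rw [tensorIncl_tmul, tensorProj_permProdEquiv, syzygyProj_coe, syzygyProj_coe]

/-- The map `k(X × Y) → Δ(X ⊔ Y)`, `(x, y) ↦ x - y`. -/
noncomputable def prodToSyzygy (k G X Y : Type u) [Field k] [Group G] [MulAction G X]
    [MulAction G Y] : (ofMulAction k G (X × Y)).IntertwiningMap (Δ k G (X ⊕ Y)) :=
  ⟨(permBasis k (X × Y)).constr k fun z => diff k G (Sum.inl z.1) (Sum.inr z.2), fun g =>
    (permBasis k (X × Y)).ext fun z => by
      simp only [LinearMap.comp_apply, perm_basis_smul, Module.Basis.constr_basis, diff_smul]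
      rfl⟩

lemma prodToSyzygy_basis (z : X × Y) : prodToSyzygy k G X Y (permBasis k (X × Y) z) =
    diff k G (Sum.inl z.1) (Sum.inr z.2) :=
  (permBasis k (X × Y)).constr_basis k _ z

/-- The section of `prodToSyzygy` given by a point of `X × Y`. -/
noncomputable def syzygySection (k : Type u) {X Y : Type u} [Field k] (z : X × Y) :
    MonoidAlgebra k (X ⊕ Y) →ₗ[k] MonoidAlgebra k (X × Y) :=
  (permBasis k (X ⊕ Y)).constr k (Sum.elim
    (fun x => permBasis k (X × Y) (x, z.2) - permBasis k (X × Y) z)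
    fun y => - permBasis k (X × Y) (z.1, y))

lemma syzygySection_inl (z : X × Y) (x : X) :
    syzygySection k z (permBasis k (X ⊕ Y) (Sum.inl x)) =
      permBasis k (X × Y) (x, z.2) - permBasis k (X × Y) z := by
  simp [syzygySection]

lemma syzygySection_inr (z : X × Y) (y : Y) :
    syzygySection k z (permBasis k (X ⊕ Y) (Sum.inr y)) = - permBasis k (X × Y) (z.1, y) := by
  simp [syzygySection]

/-- Moving the base point along with `g` makes the sections an equivariant family. This is the
splitting of the sequence over the stabilizers of points of `X × Y`. -/
lemma syzygySection_smul (g : G) (z : X × Y) (v : MonoidAlgebra k (X ⊕ Y)) :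
    syzygySection k (g • z) (ofMulAction k G (X ⊕ Y) g v) =
      ofMulAction k G (X × Y) g (syzygySection k z v) := by
  suffices H : syzygySection k (g • z) ∘ₗ ofMulAction k G (X ⊕ Y) g =
      ofMulAction k G (X × Y) g ∘ₗ syzygySection k z from DFunLike.congr_fun H v
  refine (permBasis k (X ⊕ Y)).ext ?_
  rintro (x | y)
  · rw [LinearMap.comp_apply, LinearMap.comp_apply, perm_basis_smul, Sum.smul_inl,
      syzygySection_inl, syzygySection_inl, map_sub, perm_basis_smul, perm_basis_smul]
    rfl
  · rw [LinearMap.comp_apply, LinearMap.comp_apply, perm_basis_smul, Sum.smul_inr,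
      syzygySection_inr, syzygySection_inr, map_neg, perm_basis_smul]
    rfl

/-- For `z = (x₀, y₀)`, the composite sends `x` to `(x - y₀) - (x₀ - y₀) = x - x₀` and `y` to `-(x₀
- y) = y - x₀`. It is therefore the projection of `k(X ⊔ Y)` along `x₀`, which is the identity on
`Δ(X ⊔ Y)`. -/
lemma prodToSyzygy_syzygySection (z : X × Y) (v : (syzygy k G (X ⊕ Y)).toSubmodule) :
    prodToSyzygy k G X Y (syzygySection k z v) = v := by
  suffices H : (prodToSyzygy k G X Y).toLinearMap ∘ₗ syzygySection k z =
      syzygyProj k G (X ⊕ Y) _ (augmentation_basis (X ⊕ Y) (Sum.inl z.1)) from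
    (DFunLike.congr_fun H (v : MonoidAlgebra k (X ⊕ Y))).trans (syzygyProj_coe _ _ v)
  refine (permBasis k (X ⊕ Y)).ext ?_
  rintro (x | y)
  · refine Subtype.ext ?_
    rw [LinearMap.comp_apply, syzygySection_inl, coe_syzygyProj, augmentation_basis, one_smul]
    change ((prodToSyzygy k G X Y (_ - _) : (syzygy k G (X ⊕ Y)).toSubmodule) :
      MonoidAlgebra k (X ⊕ Y)) = _
    rw [map_sub, prodToSyzygy_basis, prodToSyzygy_basis]
    simp [diff]
  · refine Subtype.ext ?_
    rw [LinearMap.comp_apply, syzygySection_inr, coe_syzygyProj, augmentation_basis, one_smul]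
    change ((prodToSyzygy k G X Y (-_) : (syzygy k G (X ⊕ Y)).toSubmodule) :
      MonoidAlgebra k (X ⊕ Y)) = _
    rw [map_neg, prodToSyzygy_basis]
    simp [diff]

/-- With `z = (x₀, y₀)`, this is the expansion of `(x - x₀) ⊗ (y - y₀)` as `(x, y) - (x, y₀) - (x₀,
y) + (x₀, y₀)`, whose last three terms are minus the section applied to `x - y`. The identity
carries the exactness of the sequence at `k(X × Y)`. -/
lemma tensorIncl_tensorProj (z : X × Y) (v : MonoidAlgebra k (X × Y)) :
    tensorIncl k G X Y (tensorProj k G z v) =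
      v - syzygySection k z (prodToSyzygy k G X Y v : MonoidAlgebra k (X ⊕ Y)) := by
  suffices H : (tensorIncl k G X Y).toLinearMap ∘ₗ tensorProj k G z = LinearMap.id -
      syzygySection k z ∘ₗ (syzygyIncl k G (X ⊕ Y)).toLinearMap ∘ₗ
        (prodToSyzygy k G X Y).toLinearMap from DFunLike.congr_fun H v
  refine (permBasis k (X × Y)).ext fun w => ?_
  have h1 : (syzygyIncl k G (X ⊕ Y)) (prodToSyzygy k G X Y (permBasis k (X × Y) w)) =
      permBasis k (X ⊕ Y) (Sum.inl w.1) - permBasis k (X ⊕ Y) (Sum.inr w.2) := by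
    rw [prodToSyzygy_basis]; rfl
  have h2 : tensorIncl k G X Y (tensorProj k G z (permBasis k (X × Y) w)) =
      permBasis k (X × Y) w - syzygySection k z
        (syzygyIncl k G (X ⊕ Y) (prodToSyzygy k G X Y (permBasis k (X × Y) w))) := by
    rw [h1, map_sub, syzygySection_inl, syzygySection_inr, ← permProdEquiv_tmul w.1 w.2,
      tensorProj_permProdEquiv, tensorIncl_tmul, coe_syzygyProj, coe_syzygyProj,
      augmentation_basis, augmentation_basis, one_smul, one_smul, TensorProduct.sub_tmul,
      TensorProduct.tmul_sub, TensorProduct.tmul_sub, map_sub, map_sub, map_sub,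
      permProdEquiv_tmul, permProdEquiv_tmul, permProdEquiv_tmul, permProdEquiv_tmul]
    abel
  exact h2

end Sum

/-! ### The relation `Ω_X + Ω_Y = Ω_{X × Y} + Ω_{X ⊔ Y}` -/

section Add

variable {p : ℕ} {k G X Y : Type u} [Field k] [Group G] [MulAction G X] [MulAction G Y]

lemma NoSylowFixedPoint.sum (hX : NoSylowFixedPoint p G X) (hY : NoSylowFixedPoint p G Y) :
    NoSylowFixedPoint p G (X ⊕ Y) := by
  rw [noSylowFixedPoint_iff] at hX hY ⊢
  rintro S (x | y) h
  · exact hX S x fun s hs => Sum.inl_injective (h s hs)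
  · exact hY S y fun s hs => Sum.inr_injective (h s hs)

lemma NoSylowFixedPoint.of_map (hX : NoSylowFixedPoint p G X) (f : Y → X)
    (hf : ∀ (g : G) y, f (g • y) = g • f y) : NoSylowFixedPoint p G Y := by
  rw [noSylowFixedPoint_iff] at hX ⊢
  exact fun S y h => hX S (f y) fun s hs => by rw [← hf, h s hs]

variable {Z N M : Type u} [MulAction G Z] [AddCommGroup N] [Module k N] [AddCommGroup M]
  [Module k M] {ν : Representation k G N} {μ : Representation k G M}

/-- The map `kZ ⊗ M → M`, `z ⊗ m ↦ m`. -/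
noncomputable def permTensorCounit (Z : Type u) [MulAction G Z] (μ : Representation k G M) :
    ((ofMulAction k G Z).tprod μ).IntertwiningMap μ :=
  ⟨(TensorProduct.lid k M).toLinearMap ∘ₗ (augmentation k Z).rTensor M, fun g =>
    TensorProduct.ext' fun v m => by simp [augmentation_smul]⟩

lemma permTensorCounit_tmul (v : MonoidAlgebra k Z) (m : M) :
    permTensorCounit Z μ (v ⊗ₜ[k] m) = augmentation k Z v • m := rfl

/-- The map `kZ → kZ ⊗ M`, `z ↦ z ⊗ e(z)`. -/
noncomputable def permTensorGraph (e : (ofMulAction k G Z).IntertwiningMap μ) :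
    (ofMulAction k G Z).IntertwiningMap ((ofMulAction k G Z).tprod μ) :=
  ⟨(permBasis k Z).constr k fun z => permBasis k Z z ⊗ₜ[k] e (permBasis k Z z), fun g =>
    (permBasis k Z).ext fun z => by
      rw [LinearMap.comp_apply, LinearMap.comp_apply, perm_basis_smul, Module.Basis.constr_basis,
        Module.Basis.constr_basis, Representation.tprod_apply, TensorProduct.map_tmul,
        perm_basis_smul, ← e.isIntertwining, perm_basis_smul]⟩

lemma permTensorGraph_basis (e : (ofMulAction k G Z).IntertwiningMap μ) (z : Z) :
    permTensorGraph e (permBasis k Z z) = permBasis k Z z ⊗ₜ[k] e (permBasis k Z z) :=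
  (permBasis k Z).constr_basis k _ z

lemma perm_tensor_ext {E : Type u} [AddCommGroup E] [Module k E]
    {a b : TensorProduct k (MonoidAlgebra k Z) M →ₗ[k] E}
    (h : ∀ z m, a (permBasis k Z z ⊗ₜ[k] m) = b (permBasis k Z z ⊗ₜ[k] m)) : a = b :=
  TensorProduct.ext ((permBasis k Z).ext fun z => LinearMap.ext fun m => h z m)

/-- The map `kZ ⊗ M → N`, `z ⊗ m ↦ s_z(m)`, for an equivariant family `s_z : M → N`. -/
noncomputable def permTensorLift (s : Z → M →ₗ[k] N)
    (hs : ∀ (g : G) z m, s (g • z) (μ g m) = ν g (s z m)) :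
    ((ofMulAction k G Z).tprod μ).IntertwiningMap ν :=
  ⟨TensorProduct.lift ((permBasis k Z).constr k s), fun g => perm_tensor_ext fun z m => by
    rw [LinearMap.comp_apply, LinearMap.comp_apply, Representation.tprod_apply,
      TensorProduct.map_tmul, perm_basis_smul, TensorProduct.lift.tmul, TensorProduct.lift.tmul,
      Module.Basis.constr_basis, Module.Basis.constr_basis, hs]⟩

lemma permTensorLift_tmul (s : Z → M →ₗ[k] N)
    (hs : ∀ (g : G) z m, s (g • z) (μ g m) = ν g (s z m)) (z : Z) (m : M) :
    permTensorLift s hs (permBasis k Z z ⊗ₜ[k] m) = s z m := by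
  change TensorProduct.lift ((permBasis k Z).constr k s) (permBasis k Z z ⊗ₜ[k] m) = _
  rw [TensorProduct.lift.tmul, Module.Basis.constr_basis]

/-- The inclusion `Δ(Z) ⊗ M → kZ ⊗ M`. -/
noncomputable def syzygyTensorIncl (Z : Type u) [MulAction G Z] (μ : Representation k G M) :
    ((Δ k G Z).tprod μ).IntertwiningMap ((ofMulAction k G Z).tprod μ) :=
  (syzygyIncl k G Z).tensor (.id μ)

lemma syzygyTensorIncl_tmul (v : (syzygy k G Z).toSubmodule) (m : M) :
    syzygyTensorIncl Z μ (v ⊗ₜ[k] m) = (v : MonoidAlgebra k Z) ⊗ₜ[k] m := rfl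

/-- The retraction of `syzygyTensorIncl` given by a point of `Z`. -/
noncomputable def syzygyTensorProj (G M : Type u) [Group G] [MulAction G Z] [AddCommGroup M]
    [Module k M] (z : Z) : TensorProduct k (MonoidAlgebra k Z) M →ₗ[k]
      TensorProduct k (syzygy k G Z).toSubmodule M :=
  (syzygyProj k G Z _ (augmentation_basis Z z)).rTensor M

lemma syzygyTensorProj_tmul (z : Z) (v : MonoidAlgebra k Z) (m : M) :
    syzygyTensorProj G M z (v ⊗ₜ[k] m) =
      syzygyProj k G Z _ (augmentation_basis Z z) v ⊗ₜ[k] m := rfl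

lemma syzygyTensorProj_smul (g : G) (z : Z) (v : TensorProduct k (MonoidAlgebra k Z) M) :
    syzygyTensorProj G M (g • z) ((ofMulAction k G Z).tprod μ g v) =
      (Δ k G Z).tprod μ g (syzygyTensorProj G M z v) := by
  suffices H : syzygyTensorProj G M (g • z) ∘ₗ (ofMulAction k G Z).tprod μ g =
      (Δ k G Z).tprod μ g ∘ₗ syzygyTensorProj G M z from DFunLike.congr_fun H v
  refine TensorProduct.ext' fun v m => ?_
  rw [LinearMap.comp_apply, LinearMap.comp_apply, Representation.tprod_apply,
    TensorProduct.map_tmul, syzygyTensorProj_tmul, syzygyTensorProj_tmul,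
    Representation.tprod_apply, TensorProduct.map_tmul]
  congr 1
  simp only [← perm_basis_smul]
  exact syzygyProj_smul ..

lemma syzygyTensorProj_incl (z : Z) (v : TensorProduct k (syzygy k G Z).toSubmodule M) :
    syzygyTensorProj G M z (syzygyTensorIncl Z μ v) = v := by
  suffices H : syzygyTensorProj G M z ∘ₗ (syzygyTensorIncl Z μ).toLinearMap = LinearMap.id from
    DFunLike.congr_fun H v
  refine TensorProduct.ext' fun v m => ?_
  change syzygyTensorProj G M z (syzygyTensorIncl Z μ (v ⊗ₜ[k] m)) = v ⊗ₜ[k] m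
  rw [syzygyTensorIncl_tmul, syzygyTensorProj_tmul, syzygyProj_coe]

/-- On the kernel of the counit the correction term disappears, so that kernel is the image of `Δ(Z)
⊗ M`. -/
lemma syzygyTensorIncl_proj (z : Z) (v : TensorProduct k (MonoidAlgebra k Z) M) :
    syzygyTensorIncl Z μ (syzygyTensorProj G M z v) =
      v - permBasis k Z z ⊗ₜ[k] permTensorCounit Z μ v := by
  suffices H : (syzygyTensorIncl Z μ).toLinearMap ∘ₗ syzygyTensorProj G M z = LinearMap.id -
      TensorProduct.mk k _ _ (permBasis k Z z) ∘ₗ (permTensorCounit Z μ).toLinearMap from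
    DFunLike.congr_fun H v
  refine TensorProduct.ext' fun v m => ?_
  change syzygyTensorIncl Z μ (syzygyTensorProj G M z (v ⊗ₜ[k] m)) =
    v ⊗ₜ[k] m - permBasis k Z z ⊗ₜ[k] permTensorCounit Z μ (v ⊗ₜ[k] m)
  rw [syzygyTensorProj_tmul, syzygyTensorIncl_tmul, permTensorCounit_tmul, coe_syzygyProj,
    TensorProduct.sub_tmul, TensorProduct.smul_tmul]

/-- If `0 → N → kZ → M → 0` splits after restriction to the stabilizers of `Z`, then `N`
divides `Δ(Z) ⊗ M ⊕ kZ`. -/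
lemma isSummand_syzygy_tprod (i : ν.IntertwiningMap (ofMulAction k G Z))
    (e : (ofMulAction k G Z).IntertwiningMap μ) (s : Z → M →ₗ[k] MonoidAlgebra k Z)
    (hs : ∀ (g : G) z m, s (g • z) (μ g m) = ofMulAction k G Z g (s z m))
    (hes : ∀ z m, e (s z m) = m) (z₀ : Z) (q : MonoidAlgebra k Z →ₗ[k] N)
    (hq : ∀ n, q (i n) = n) (hei : ∀ n, e (i n) = 0) (hiq : ∀ v, e v = 0 → i (q v) = v) :
    IsSummand (W := TensorProduct k (syzygy k G Z).toSubmodule M × MonoidAlgebra k Z) ν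
      (((Δ k G Z).tprod μ).prod (ofMulAction k G Z)) := by
  -- The given sequence is compared with `0 → Δ(Z) ⊗ M → kZ ⊗ M → M → 0`. The graph of `e` lifts `kZ
  -- → M` to `kZ ⊗ M` without any splitting; the lift in the other direction is assembled from the
  -- sections `s z`.
  refine isSummand_prod_of_lifts (N' := TensorProduct k (syzygy k G Z).toSubmodule M)
    (P' := TensorProduct k (MonoidAlgebra k Z) M) i e (syzygyTensorIncl Z μ) (permTensorCounit Z μ)
    (permTensorGraph e) (permTensorLift s hs) ?_ ?_ q hq hei hiq (syzygyTensorProj G M z₀)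
    (syzygyTensorProj_incl z₀) ?_ ?_
  · intro v
    suffices H : (permTensorCounit Z μ).toLinearMap ∘ₗ (permTensorGraph e).toLinearMap =
      e.toLinearMap from DFunLike.congr_fun H v
    refine (permBasis k Z).ext fun z => ?_
    change permTensorCounit Z μ (permTensorGraph e (permBasis k Z z)) = e (permBasis k Z z)
    rw [permTensorGraph_basis, permTensorCounit_tmul, augmentation_basis, one_smul]
  · intro v
    suffices H : e.toLinearMap ∘ₗ (permTensorLift s hs).toLinearMap =
      (permTensorCounit Z μ).toLinearMap from DFunLike.congr_fun H v
    refine perm_tensor_ext fun z m => ?_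
    change e (permTensorLift s hs (permBasis k Z z ⊗ₜ[k] m)) =
      permTensorCounit Z μ (permBasis k Z z ⊗ₜ[k] m)
    rw [permTensorLift_tmul, hes, permTensorCounit_tmul, augmentation_basis, one_smul]
  · intro n
    suffices H : (permTensorCounit Z μ).toLinearMap ∘ₗ (syzygyTensorIncl Z μ).toLinearMap = 0 from
      DFunLike.congr_fun H n
    refine TensorProduct.ext' fun v m => ?_
    have hv : augmentation k Z v = 0 := v.2
    change permTensorCounit Z μ (syzygyTensorIncl Z μ (v ⊗ₜ[k] m)) = 0
    rw [syzygyTensorIncl_tmul, permTensorCounit_tmul, hv, zero_smul]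
  · intro v hv
    rw [syzygyTensorIncl_proj, hv, TensorProduct.tmul_zero, sub_zero]

/-- The retractions make `Hom(kZ, N)` a summand of `Hom(kZ, M)`, a Hom-module between
`p`-permutation modules. Duality then reverses the arguments. -/
lemma isPPermutation_linHom_of_split [Finite Z] [Module.Finite k N] (hp : IsPPermutation μ)
    (i : ν.IntertwiningMap μ) (q : Z → M →ₗ[k] N)
    (hq : ∀ (g : G) z v, q (g • z) (μ g v) = ν g (q z v)) (h : ∀ z v, q z (i v) = v) :
    IsPPermutation (linHom ν (ofMulAction k G Z)) := by
  have := perm_finite (k := k) (X := Z)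
  exact ((isPPermutation_perm.linHom hp).summand (isSummand_linHom_perm i q hq h)).linHom_symm

variable [Finite G] [Fact p.Prime] [CharP k p]

/-- If `0 → N → kZ → M → 0` splits after restriction to the stabilizers of `Z`, then
`[N] = Ω_Z + [M]`. -/
lemma compatible_syzygy_tprod [Finite Z] [Nonempty Z] (hZ : NoSylowFixedPoint p G Z)
    (hν : IsDade p ν ∧ IsCapped p ν) (hμ : IsDade p μ ∧ IsCapped p μ)
    (hp : IsPPermutation ((ofMulAction k G Z).tprod μ))
    (i : ν.IntertwiningMap (ofMulAction k G Z))
    (e : (ofMulAction k G Z).IntertwiningMap μ) (s : Z → M →ₗ[k] MonoidAlgebra k Z)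
    (hs : ∀ (g : G) z m, s (g • z) (μ g m) = ofMulAction k G Z g (s z m))
    (hes : ∀ z m, e (s z m) = m) (z₀ : Z) (q : MonoidAlgebra k Z →ₗ[k] N)
    (hq : ∀ n, q (i n) = n) (hei : ∀ n, e (i n) = 0) (hiq : ∀ v, e v = 0 → i (q v) = v) :
    Compatible (V := TensorProduct k (syzygy k G Z).toSubmodule M) p ((Δ k G Z).tprod μ) ν := by
  have := perm_finite (k := k) (X := Z)
  have := hμ.1.1
  -- The relatively projective module is `kZ`. That `Hom(Δ(Z) ⊗ M, kZ)` is a `p`-permutation module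
  -- is seen by embedding `Δ(Z) ⊗ M` in `kZ ⊗ M`, split over stabilizers of `Z`; only `kZ ⊗ M`, not
  -- `M`, has to be `p`-permutation for this.
  exact compatible_of_isSummand_prod (capped_tprod (capped_syzygy hZ) hμ).1 hν.1
    (inIdeal_perm hZ)
    (isPPermutation_linHom_of_split (N := TensorProduct k (syzygy k G Z).toSubmodule M)
      (M := TensorProduct k (MonoidAlgebra k Z) M) hp (syzygyTensorIncl Z μ)
      (syzygyTensorProj G M) (fun g z v => syzygyTensorProj_smul g z v) syzygyTensorProj_incl)
    (isSummand_syzygy_tprod i e s hs hes z₀ q hq hei hiq)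

lemma D.mk_eq_of_compatible {h : IsDade p ν ∧ IsCapped p ν} {h' : IsDade p μ ∧ IsCapped p μ}
    (hc : Compatible p ν μ) : D.mk ν h = D.mk μ h' := Quotient.sound hc

lemma D.mk_add_mk (h : IsDade p ν ∧ IsCapped p ν) (h' : IsDade p μ ∧ IsCapped p μ) :
    D.mk ν h + D.mk μ h' = D.mk (ν.tprod μ) (capped_tprod h h') := rfl

/-- `Ω_X + Ω_Y = Ω_{X × Y} + Ω_{X ⊔ Y}`. -/
lemma Ω_add_Ω [Finite X] [Nonempty X] [Finite Y] [Nonempty Y]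
    (hX : NoSylowFixedPoint p G X) (hY : NoSylowFixedPoint p G Y)
    (hXY : NoSylowFixedPoint p G (X × Y)) (hXY' : NoSylowFixedPoint p G (X ⊕ Y)) :
    Ω p k G X hX + Ω p k G Y hY = Ω p k G (X × Y) hXY + Ω p k G (X ⊕ Y) hXY' := by
  obtain ⟨z₀⟩ : Nonempty (X × Y) := inferInstance
  -- A point `(x, y)` of `X × Y` supplies the point `x` of `X ⊔ Y`, fixed by the stabilizer of `(x,
  -- y)`. So `Δ(X ⊔ Y)` is split in `k(X ⊔ Y)` over these stabilizers.
  have h1 : IsPPermutation ((ofMulAction k G (X × Y)).tprod (Δ k G (X ⊕ Y))) :=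
    (isPPermutation_perm.tprod isPPermutation_perm).summand
      (isSummand_perm_tprod_syzygy (fun z => permBasis k (X ⊕ Y) (Sum.inl z.1))
        (fun g z => (perm_basis_smul (X ⊕ Y) g (Sum.inl z.1)).symm) fun z => augmentation_basis _ _)
  have hs : ∀ (g : G) z (m : (syzygy k G (X ⊕ Y)).toSubmodule),
      (syzygySection k (g • z) ∘ₗ (syzygy k G (X ⊕ Y)).toSubmodule.subtype)
        (Δ k G (X ⊕ Y) g m) = ofMulAction k G (X × Y) g
        ((syzygySection k z ∘ₗ (syzygy k G (X ⊕ Y)).toSubmodule.subtype) m) :=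
    fun g z m => syzygySection_smul g z (m : MonoidAlgebra k (X ⊕ Y))
  -- Applied to an element of the image, `tensorIncl_tensorProj` shows that the section kills its
  -- image in `Δ(X ⊔ Y)`. The section is injective there, having `prodToSyzygy` as a left inverse.
  have hei : ∀ n, prodToSyzygy k G X Y (tensorIncl k G X Y n) = 0 := fun n => by
    have h1 := tensorIncl_tensorProj (G := G) z₀ (tensorIncl k G X Y n)
    rw [tensorProj_tensorIncl, eq_comm, sub_eq_self] at h1
    rw [← prodToSyzygy_syzygySection z₀ (prodToSyzygy k G X Y (tensorIncl k G X Y n)), h1,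
      map_zero]
  have hiq : ∀ v, prodToSyzygy k G X Y v = 0 →
      tensorIncl k G X Y (tensorProj k G z₀ v) = v := fun v hv => by
    rw [tensorIncl_tensorProj, hv, ZeroMemClass.coe_zero, map_zero, sub_zero]
  have h2 := compatible_syzygy_tprod (N := TensorProduct k (syzygy k G X).toSubmodule
      (syzygy k G Y).toSubmodule) hXY (capped_tprod (capped_syzygy hX) (capped_syzygy hY))
    (capped_syzygy hXY') h1 (tensorIncl k G X Y) (prodToSyzygy k G X Y)
    (fun z => syzygySection k z ∘ₗ (syzygy k G (X ⊕ Y)).toSubmodule.subtype) hs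
    prodToSyzygy_syzygySection z₀ (tensorProj k G z₀) (tensorProj_tensorIncl z₀) hei hiq
  rw [Ω, Ω, Ω, Ω, D.mk_add_mk, D.mk_add_mk]
  exact (D.mk_eq_of_compatible h2).symm

end Add

/-! ### Generation by the classes of transitive sets `G/P` -/

section Generation

variable {p : ℕ} {k G X Y : Type u} [Field k] [Group G] [MulAction G X] [MulAction G Y]

lemma fixingSubgroups_mono (f : X → Y) (hf : ∀ (g : G) x, f (g • x) = g • f x) :
    fixingSubgroups p G X ⊆ fixingSubgroups p G Y := by
  rintro Q ⟨hQ, x, hx⟩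
  refine ⟨hQ, f x, fun q hq => ?_⟩
  rw [MulAction.mem_stabilizer_iff, ← hf, MulAction.mem_stabilizer_iff.1 (hx hq)]

lemma fixingSubgroups_sum : fixingSubgroups p G (X ⊕ Y) =
    fixingSubgroups p G X ∪ fixingSubgroups p G Y := by
  refine subset_antisymm ?_ (Set.union_subset (fixingSubgroups_mono Sum.inl fun _ _ => rfl)
    (fixingSubgroups_mono Sum.inr fun _ _ => rfl))
  rintro Q ⟨hQ, x | y, hx⟩
  · exact Or.inl ⟨hQ, x, fun q hq => Sum.inl_injective (hx hq)⟩
  · exact Or.inr ⟨hQ, y, fun q hq => Sum.inr_injective (hx hq)⟩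

lemma smul_coe_eq_iff {P : Subgroup G} {q g : G} :
    q • (g : G ⧸ P) = g ↔ g⁻¹ * q * g ∈ P := by
  rw [MulAction.Quotient.smul_coe, eq_comm, QuotientGroup.eq, smul_eq_mul, mul_assoc]

/-- The reason is the `G`-map `G/P → X` sending `gP` to `g • x`, well defined because `P` fixes `x`.
-/
lemma fixingSubgroups_quotient_subset {P : Subgroup G} {x : X}
    (h : P ≤ MulAction.stabilizer G x) :
    fixingSubgroups p G (G ⧸ P) ⊆ fixingSubgroups p G X := by
  rintro Q ⟨hQ, c, hc⟩
  induction c using QuotientGroup.induction_on with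
  | H g =>
    refine ⟨hQ, g • x, fun q hq => ?_⟩
    have h1 := h (smul_coe_eq_iff.1 (hc hq))
    rwa [MulAction.mem_stabilizer_iff, mul_smul, mul_smul, inv_smul_eq_iff] at h1

/-- If `Q = gPg⁻¹`, then `P` fixes the coset `g⁻¹Q` and `Q` fixes the coset `gP`, which gives the
two inclusions. Invariance of `Ω_{G/P}` under conjugation follows from this. -/
lemma fixingSubgroups_quotient_eq_of_conj {P Q : Subgroup G} {g : G}
    (h : Q = P.map (MulAut.conj g).toMonoidHom) :
    fixingSubgroups p G (G ⧸ P) = fixingSubgroups p G (G ⧸ Q) := by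
  refine subset_antisymm (fixingSubgroups_quotient_subset (x := ((g⁻¹ : G) : G ⧸ Q)) ?_)
    (fixingSubgroups_quotient_subset (x := ((g : G) : G ⧸ P)) ?_)
  · intro q hq
    rw [MulAction.mem_stabilizer_iff, smul_coe_eq_iff, h]
    exact ⟨q, hq, by simp⟩
  · intro q hq
    rw [h] at hq
    obtain ⟨y, hy, rfl⟩ := hq
    rw [MulAction.mem_stabilizer_iff, smul_coe_eq_iff]
    simpa [mul_assoc] using hy

variable [Finite G] [Fact p.Prime]

/-- If `P` has maximal order among the `p`-subgroups of `G` that fix a point of `X`, and fixes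
a point in the orbit of `x`, then every `p`-subgroup that fixes `x` fixes a point of `G/P`. -/
lemma mem_fixingSubgroups_quotient {P Q : Subgroup G} (hP : P ∈ fixingSubgroups p G X)
    (hmax : ∀ R ∈ fixingSubgroups p G X, Nat.card R ≤ Nat.card P) {x : X} {g : G}
    (hPx : P ≤ MulAction.stabilizer G (g • x)) (hQ : IsPGroup p Q)
    (hQx : Q ≤ MulAction.stabilizer G x) : Q ∈ fixingSubgroups p G (G ⧸ P) := by
  set H := MulAction.stabilizer G x
  let P' := P.map (MulAut.conj g⁻¹).toMonoidHom
  have hP' : IsPGroup p P' := hP.1.map _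
  have hP'x : P' ≤ H := by
    rintro _ ⟨y, hy, rfl⟩
    have h1 := hPx hy
    rw [MulAction.mem_stabilizer_iff] at h1
    change ((MulAut.conj g⁻¹).toMonoidHom y) • x = x
    simp [mul_smul, h1]
  -- Both `P' = g⁻¹Pg` and `Q` are `p`-subgroups of the stabilizer `H` of `x`. They are placed in
  -- Sylow subgroups of `H`, which are conjugate by some `h ∈ H`.
  obtain ⟨T, hT⟩ := (hP'.comap_of_injective H.subtype H.subtype_injective).exists_le_sylow
  obtain ⟨T', hT'⟩ := (hQ.comap_of_injective H.subtype H.subtype_injective).exists_le_sylow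
  obtain ⟨h, rfl⟩ := MulAction.exists_smul_eq H T T'
  have h1 : P' ≤ (T : Subgroup H).map H.subtype := fun y hy =>
    ⟨⟨y, hP'x hy⟩, hT hy, rfl⟩
  -- `T` is itself a `p`-subgroup fixing `x`, so maximality bounds its order by that of `P`. Hence
  -- `P'` is a full Sylow subgroup of `H`.
  have h2 : P' = (T : Subgroup H).map H.subtype := by
    refine Subgroup.eq_of_le_of_card_ge h1 ?_
    have h2 : Nat.card P' = Nat.card P :=
      Subgroup.card_map_of_injective (MulAut.conj g⁻¹).injective
    rw [h2]
    exact hmax _ ⟨T.isPGroup'.map _, x, Subgroup.map_subtype_le _⟩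
  -- `Q ≤ hP'h⁻¹ = (hg⁻¹)P(hg⁻¹)⁻¹`, and the latter is the stabilizer of the coset `hg⁻¹P`.
  refine ⟨hQ, ((h * g⁻¹ : G) : G ⧸ P), fun q hq => ?_⟩
  rw [MulAction.mem_stabilizer_iff, smul_coe_eq_iff]
  have h3 : (⟨q, hQx hq⟩ : H) ∈ ((h • T : Sylow p H) : Subgroup H) := hT' hq
  rw [Sylow.coe_subgroup_smul, Subgroup.mem_pointwise_smul_iff_inv_smul_mem] at h3
  have h4 : ((h : G)⁻¹ * q * h) ∈ P' := by
    rw [h2]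
    exact ⟨_, h3, by simp⟩
  obtain ⟨y, hy, hyq⟩ := h4
  have h5 : g⁻¹ * y * g = (h : G)⁻¹ * q * h := by simpa using hyq
  have h6 : (h * g⁻¹ : G)⁻¹ * q * (h * g⁻¹) = y := by
    calc (h * g⁻¹ : G)⁻¹ * q * (h * g⁻¹) = g * ((h : G)⁻¹ * q * h) * g⁻¹ := by group
      _ = y := by rw [← h5]; group
  rw [h6]
  exact hy

variable [CharP k p]

/-- Strong induction on the number of `p`-subgroups fixing a point, rather than on the size of `X`:
the product `G/P × Y` in the relation may be larger than `X`, but it has fewer fixing `p`-subgroups.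
-/
lemma Ω_mem_closure (X : Type u) [MulAction G X] [Finite X] [Nonempty X]
    (hX : NoSylowFixedPoint p G X) :
    Ω p k G X hX ∈ AddSubgroup.closure (Set.range fun P : nonSylow p G =>
      Ω p k G (G ⧸ P.1) (noSylowFixedPoint_of_nonSylow P)) := by
  induction hn : (fixingSubgroups p G X).ncard using Nat.strong_induction_on generalizing X with
  | _ n ih =>
  subst hn
  obtain ⟨x₀⟩ := id ‹Nonempty X›
  obtain ⟨P, hP, hmax⟩ := Set.exists_max_image (fixingSubgroups p G X)
    (fun P => Nat.card P) (Set.toFinite _) ⟨⊥, IsPGroup.of_bot, x₀, bot_le⟩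
  obtain ⟨y, hy⟩ := hP.2
  have hPS : P ∈ nonSylow p G := by
    refine ⟨hP.1, fun S hS => noSylowFixedPoint_iff.1 hX S y fun s hs => ?_⟩
    exact hy (hS ▸ hs)
  have hPX := noSylowFixedPoint_of_nonSylow ⟨P, hPS⟩
  have hmem : Ω p k G (G ⧸ P) hPX ∈ AddSubgroup.closure (Set.range fun P : nonSylow p G =>
      Ω p k G (G ⧸ P.1) (noSylowFixedPoint_of_nonSylow P)) :=
    AddSubgroup.subset_closure ⟨⟨P, hPS⟩, rfl⟩
  -- The union of those orbits of `X` that contain no point fixed by `P`.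
  let Y : SubMulAction G X :=
    { carrier := {x | ∀ g : G, ¬ P ≤ MulAction.stabilizer G (g • x)}
      smul_mem' := fun h x hx g => by rw [smul_smul]; exact hx _ }
  have hYX : fixingSubgroups p G Y ⊆ fixingSubgroups p G X :=
    fixingSubgroups_mono Subtype.val fun _ _ => rfl
  have hPY : P ∉ fixingSubgroups p G Y := by
    rintro ⟨-, z, hz⟩
    refine z.2 1 fun q hq => ?_
    rw [one_smul]
    exact congrArg Subtype.val (hz hq)
  have hXY : fixingSubgroups p G X =
      fixingSubgroups p G (G ⧸ P) ∪ fixingSubgroups p G Y := by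
    refine subset_antisymm ?_ (Set.union_subset (fixingSubgroups_quotient_subset hy) hYX)
    rintro Q ⟨hQ, x, hx⟩
    by_cases hxY : x ∈ Y
    · exact Or.inr ⟨hQ, ⟨x, hxY⟩, fun q hq => Subtype.ext (hx hq)⟩
    · obtain ⟨g, hg⟩ : ∃ g : G, P ≤ MulAction.stabilizer G (g • x) := by
        by_contra! hcon
        exact hxY hcon
      exact Or.inl (mem_fixingSubgroups_quotient hP hmax hg hQ hx)
  have hlt : (fixingSubgroups p G Y).ncard < (fixingSubgroups p G X).ncard :=
    Set.ncard_lt_ncard ⟨hYX, fun h => hPY (h hP)⟩ (Set.toFinite _)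
  have hY : NoSylowFixedPoint p G Y := hX.of_map Subtype.val fun _ _ => rfl
  -- `Ω` is only available for non-empty sets. If `Y` is empty, then `X` and `G/P` have the same
  -- fixing subgroups and `Ω_X` is a generator.
  obtain hE | hE := isEmpty_or_nonempty Y
  · have h1 : fixingSubgroups p G Y = ∅ :=
      Set.eq_empty_iff_forall_notMem.2 fun Q hQ => hE.elim hQ.2.choose
    rw [h1, Set.union_empty] at hXY
    rwa [Ω_eq_of_fixingSubgroups_eq hX hPX hXY]
  · have hprod : NoSylowFixedPoint p G ((G ⧸ P) × Y) := hY.of_map Prod.snd fun _ _ => rfl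
    have hle : (fixingSubgroups p G ((G ⧸ P) × Y)).ncard ≤ (fixingSubgroups p G Y).ncard :=
      Set.ncard_le_ncard (fixingSubgroups_mono Prod.snd fun _ _ => rfl) (Set.toFinite _)
    -- `X` is replaced by `G/P ⊔ Y`, and the relation is solved for its class: `Ω_X = Ω_{G/P} + Ω_Y
    -- - Ω_{G/P × Y}`. Induction covers the last two terms.
    rw [Ω_eq_of_fixingSubgroups_eq hX (hPX.sum hY) (hXY.trans fixingSubgroups_sum.symm),
      ← add_sub_cancel_left (Ω p k G _ hprod) (Ω p k G _ (hPX.sum hY)), ← Ω_add_Ω hPX hY]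
    exact sub_mem (add_mem hmem (ih _ hlt Y hY rfl))
      (ih _ (hle.trans_lt hlt) _ hprod rfl)

end Generation

end DadeGroup

/-- The generators are indexed by subgroups instead of conjugacy classes; by the first assertion
both indexings give the same set of elements. -/
theorem mainTheorem8 (p : ℕ) [Fact p.Prime] (k G : Type u) [Field k] [IsAlgClosed k] [CharP k p]
    [Group G] [Finite G] :
    (∀ P Q : DadeGroup.nonSylow p G, (∃ g : G, Q.1 = P.1.map (MulAut.conj g).toMonoidHom) →
      DadeGroup.Ω p k G (G ⧸ P.1) (DadeGroup.noSylowFixedPoint_of_nonSylow P) =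
        DadeGroup.Ω p k G (G ⧸ Q.1) (DadeGroup.noSylowFixedPoint_of_nonSylow Q)) ∧
    (Set.range fun P : DadeGroup.nonSylow p G =>
      DadeGroup.Ω p k G (G ⧸ P.1) (DadeGroup.noSylowFixedPoint_of_nonSylow P)).Finite ∧
    AddSubgroup.closure (Set.range fun P : DadeGroup.nonSylow p G =>
      DadeGroup.Ω p k G (G ⧸ P.1) (DadeGroup.noSylowFixedPoint_of_nonSylow P)) =
        DadeGroup.DΩ p k G := by
  refine ⟨fun P Q ⟨g, hg⟩ => DadeGroup.Ω_eq_of_fixingSubgroups_eq _ _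
    (DadeGroup.fixingSubgroups_quotient_eq_of_conj hg), Set.finite_range _, le_antisymm ?_ ?_⟩
  · refine AddSubgroup.closure_mono ?_
    rintro _ ⟨P, rfl⟩
    exact ⟨G ⧸ P.1, inferInstance, inferInstance, inferInstance, _, rfl⟩
  · refine (AddSubgroup.closure_le _).2 ?_
    rintro _ ⟨X, _, _, _, hX, rfl⟩
    exact DadeGroup.Ω_mem_closure X hX
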